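/- Let $R$ be a commutative ring with identity that is quasi-local (it has exactly one maximal ideal $m$; it need not be Noetherian) and coherent (every finitely generated ideal of $R$ is finitely presented as a module), and let $n\ge 0$ be an integer. Then the following are equivalent: 1. $\operatorname{FP-id}_R R=n$; 2. $R$ is Gorenstein and $\operatorname{depth} R=n$. Here the terms are defined as follows. For an $R$-module $M$, the *FP-injective dimension* is $$\operatorname{FP-id}_R M=\inf\{k\ge 0\mid \operatorname{Ext}^{k+1}_R(N,M)=0\text{ for every finitely presented }R\text{-module }N\},$$ where the infimum of the empty set is $\infty$. For an ideal $I$ and an $R$-module $M$ with $IM\ne M$, let $\operatorname{Depth}_I M$ be the supremum of the lengths of the regular sequences on $M$ contained in $I$, and let $\operatorname{depth}_I M$ be the supremum of $\operatorname{Depth}_{IS}(M\otimes_R S)$ over all faithfully flat commutative $R$-algebras $S$; put $\operatorname{depth} R=\operatorname{depth}_m R$. Write $M^*=\operatorname{Hom}_R(M,R)$. The *G-class* of $R$ consists of the finitely generated $R$-modules $M$ such that $\operatorname{Ext}^i_R(M,R)=0$ and $\operatorname{Ext}^i_R(M^*,R)=0$ for all $i>0$ and the natural map $M\to M^{**}$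 is an isomorphism. A *G-resolution* of $M$ is an exact sequence $\cdots\to G_1\to G_0\to M\to 0$ with every $G_i$ in the G-class; its length is the supremum of the $i$ with $G_i\ne 0$ (and $0$ if all $G_i$ vanish). The module $M$ has *finite G-dimension* if it has a G-resolution of finite length. The quasi-local ring $R$ is *Gorenstein* if every finitely generated ideal of $R$ has finite G-dimension. -/

import Mathlib

open CategoryTheory TensorProduct

universe u

namespace CoherentGorenstein

/-- A commutative ring is coherent if every finitely generated ideal is finitely presented. -/
def IsCoherentRing (R : Type u) [CommRing R] : Prop :=
  ∀ I : Ideal R, I.FG → Module.FinitePresentation R I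

/-- `Ext^i_R(M, N) = 0`. -/
def ExtVanishes (R : Type u) [CommRing R] (M N : Type u) [AddCommGroup M] [Module R M]
    [AddCommGroup N] [Module R N] (i : ℕ) : Prop :=
  Subsingleton (Abelian.Ext (ModuleCat.of R M) (ModuleCat.of R N) i)

/-- The FP-injective dimension of `M`: the infimum of the `n` such that `Ext^{n+1}_R(N, M) = 0` for
every finitely presented `N`, with `⊤` as the infimum of the empty set. -/
noncomputable def fpInjectiveDim (R : Type u) [CommRing R] (M : Type u) [AddCommGroup M]
    [Module R M] : ℕ∞ :=
  sInf {k : ℕ∞ | ∃ n : ℕ, k = n ∧ ∀ (N : Type u) [AddCommGroup N] [Module R N],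
    Module.FinitePresentation R N → ExtVanishes R N M (n + 1)}

/-- The classical depth of `M` with respect to `I`: the supremum of the lengths of the
`M`-regular sequences contained in `I`. -/
noncomputable def classicalDepth {R : Type u} [CommRing R] (I : Ideal R) (M : Type u)
    [AddCommGroup M] [Module R M] : ℕ∞ :=
  sSup {k : ℕ∞ | ∃ rs : List R, (∀ r ∈ rs, r ∈ I) ∧ RingTheory.Sequence.IsRegular M rs ∧
    k = rs.length}

/-- The depth of `M` with respect to `I`: the supremum, over all faithfully flat (commutative)
`R`-algebras `S`, of the classical depth of `S ⊗ M` with respect to the extended ideal `IS`. -/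
noncomputable def depth {R : Type u} [CommRing R] (I : Ideal R) (M : Type u)
    [AddCommGroup M] [Module R M] : ℕ∞ :=
  ⨆ (S : Type u) (_ : CommRing S) (_ : Algebra R S) (_ : Module.FaithfullyFlat R S),
    classicalDepth (I.map (algebraMap R S)) (S ⊗[R] M)

/-- The depth of a quasi-local ring, i.e. of the module `R` with respect to the maximal ideal. -/
noncomputable def ringDepth (R : Type u) [CommRing R] [IsLocalRing R] : ℕ∞ :=
  depth (IsLocalRing.maximalIdeal R) R

/-- The G-class of `R`. -/
structure GClass (R : Type u) [CommRing R] (M : Type u) [AddCommGroup M] [Module R M] :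
    Prop where
  finite : Module.Finite R M
  ext_vanishes : ∀ i : ℕ, 0 < i → ExtVanishes R M R i
  ext_dual_vanishes : ∀ i : ℕ, 0 < i → ExtVanishes R (Module.Dual R M) R i
  /-- The natural map `M → M**` is an isomorphism. -/
  bijective_eval : Function.Bijective (Module.Dual.eval R M)

/-- A G-resolution of `M`: an exact sequence `⋯ → G₂ → G₁ → G₀ → M → 0` with every `Gₙ` in the
G-class of `R`. -/
structure GResolution (R : Type u) [CommRing R] (M : Type u) [AddCommGroup M] [Module R M] where
  G : ℕ → ModuleCat.{u} R
  d : ∀ n : ℕ, G (n + 1) →ₗ[R] G n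
  ε : G 0 →ₗ[R] M
  gClass : ∀ n : ℕ, GClass R (G n)
  exact_d : ∀ n : ℕ, Function.Exact (d (n + 1)) (d n)
  exact_ε : Function.Exact (d 0) ε
  surjective_ε : Function.Surjective ε

/-- The length of a G-resolution: the supremum of the `n` with `Gₙ ≠ 0`, which is `⊤` if there are
infinitely many such `n`, and `0` if there is none. -/
noncomputable def GResolution.length {R : Type u} [CommRing R] {M : Type u} [AddCommGroup M]
    [Module R M] (P : GResolution R M) : ℕ∞ :=
  sSup {k : ℕ∞ | ∃ n : ℕ, k = n ∧ Nontrivial (P.G n)}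

/-- The G-dimension of `M`: the infimum of the lengths of the G-resolutions of `M`. It is `⊤` if no
G-resolution has finite length, in particular if `M` has no G-resolution. -/
noncomputable def gDim (R : Type u) [CommRing R] (M : Type u) [AddCommGroup M] [Module R M] :
    ℕ∞ :=
  ⨅ P : GResolution R M, P.length

/-- A quasi-local ring is Gorenstein if every finitely generated ideal has finite G-dimension. -/
def IsGorenstein (R : Type u) [CommRing R] [IsLocalRing R] : Prop :=
  ∀ I : Ideal R, I.FG → gDim R I < ⊤

end CoherentGorenstein

/-! Coherence makes kernels and duals of finitely presented modules finitely presented, so syzygies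
and dimension shifting never leave that class.

Suppose FP-id R ≤ n. If N is finitely presented and Ext^i(N, R) = 0 for all i > 0, then N is totally
reflexive (`IsCoherentRing.isTotallyReflexive`). Every n-th syzygy satisfies this condition, so all
finitely presented modules have finite G-dimension. For depth ≤ n, take a longer regular sequence
over a faithfully flat S. It lies in JS for some finitely generated J ⊆ m and kills Ext^i(R/J, S)
for i ≤ n, hence Ext^i(R/J, R) by descent. Now all Ext^i(R/J, R) vanish, so R/J is totally reflexive
with zero dual, hence zero, a contradiction.

The other inequality is half of the Auslander–Bridger formula: finite G-dimension gives Ext^i(N, R)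
= 0 for i > depth R (`IsCoherentRing.extVanishes_of_ringDepth_lt`). N embeds, with totally reflexive
cokernel, in a module W with a finite free resolution, which reduces the claim to W. A resolution of
W can be shortened while its last map splits. When it does not split, its length is at most the
depth: some unimodular v has d(v) in mT, and the polynomial whose coefficients are the coordinates
of d(v) is regular by McCoy's theorem. Dividing by it shortens the complex by one, and iteration
builds a regular sequence over a polynomial extension.

Conversely, a Gorenstein ring of depth n has FP-id at most n + 1 by this inequality. Finiteness is
enough, since a finite FP-id equals the depth. -/

namespace CoherentGorenstein

/-! ### Vanishing of Ext along short exact sequences, first variable -/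

section ExtVanishing

variable {R : Type u} [CommRing R]
  {A B C Y : Type u} [AddCommGroup A] [Module R A] [AddCommGroup B] [Module R B]
  [AddCommGroup C] [Module R C] [AddCommGroup Y] [Module R Y]

theorem ExtVanishes.of_forall_eq_zero {i : ℕ}
    (h : ∀ x : Abelian.Ext (ModuleCat.of R A) (ModuleCat.of R Y) i, x = 0) :
    ExtVanishes R A Y i :=
  subsingleton_of_forall_eq 0 h

theorem ExtVanishes.eq_zero {i : ℕ} (h : ExtVanishes R A Y i)
    (x : Abelian.Ext (ModuleCat.of R A) (ModuleCat.of R Y) i) : x = 0 :=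
  h.elim _ _

theorem ExtVanishes.of_projective [Module.Projective R A] {i : ℕ} (hi : 0 < i) :
    ExtVanishes R A Y i := by
  obtain ⟨k, rfl⟩ := Nat.exists_eq_add_of_lt hi
  rw [zero_add]
  have : Projective (ModuleCat.of R A) := inferInstance
  exact Abelian.Ext.subsingleton_of_projective _ _ _

theorem extVanishes_zero_iff :
    ExtVanishes R A Y 0 ↔ ∀ f : A →ₗ[R] Y, f = 0 := by
  constructor
  · intro h f
    have := h.eq_zero (Abelian.Ext.mk₀ (ModuleCat.ofHom f))
    rw [Abelian.Ext.mk₀_eq_zero_iff] at this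
    simpa using congrArg ModuleCat.Hom.hom this
  · intro h
    refine .of_forall_eq_zero fun x ↦ ?_
    obtain ⟨f, rfl⟩ := Abelian.Ext.mk₀_bijective _ _ |>.surjective x
    rw [Abelian.Ext.mk₀_eq_zero_iff]
    ext1
    exact h f.hom

variable {i : A →ₗ[R] B} {p : B →ₗ[R] C} (hi : Function.Injective i)
  (hip : Function.Exact i p) (hp : Function.Surjective p)

/-- The short exact sequence of module categories attached to an exact sequence
`0 → A → B → C → 0` of modules. -/
abbrev shortComplexOfExact (hip : Function.Exact i p) : ShortComplex (ModuleCat.{u} R) :=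
  ShortComplex.mk (ModuleCat.ofHom i) (ModuleCat.ofHom p)
    (by ext x; exact hip.apply_apply_eq_zero x)

include hi hp in
theorem shortComplexOfExact_shortExact : (shortComplexOfExact hip).ShortExact :=
  ModuleCat.shortComplex_shortExact _ hip hi hp

include hi hip hp

theorem ExtVanishes.middle {k : ℕ} (hA : ExtVanishes R A Y k) (hC : ExtVanishes R C Y k) :
    ExtVanishes R B Y k := by
  refine .of_forall_eq_zero fun x ↦ ?_
  obtain ⟨y, rfl⟩ := Abelian.Ext.contravariant_sequence_exact₂
    (shortComplexOfExact_shortExact hi hip hp) _ x (hA.eq_zero _)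
  rw [hC.eq_zero y, Abelian.Ext.comp_zero]

theorem ExtVanishes.left {k : ℕ} (hB : ExtVanishes R B Y k) (hC : ExtVanishes R C Y (k + 1)) :
    ExtVanishes R A Y k := by
  refine .of_forall_eq_zero fun x ↦ ?_
  obtain ⟨y, rfl⟩ := Abelian.Ext.contravariant_sequence_exact₁
    (shortComplexOfExact_shortExact hi hip hp) _ x (add_comm 1 k) (hC.eq_zero _)
  rw [hB.eq_zero y, Abelian.Ext.comp_zero]

theorem ExtVanishes.right {k : ℕ} (hA : ExtVanishes R A Y k) (hB : ExtVanishes R B Y (k + 1)) :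
    ExtVanishes R C Y (k + 1) := by
  refine .of_forall_eq_zero fun x ↦ ?_
  obtain ⟨y, rfl⟩ := Abelian.Ext.contravariant_sequence_exact₃
    (shortComplexOfExact_shortExact hi hip hp) _ x (hB.eq_zero _) (add_comm 1 k)
  rw [hA.eq_zero y, Abelian.Ext.comp_zero]

theorem ExtVanishes.exists_extension (hC : ExtVanishes R C Y 1) (f : A →ₗ[R] Y) :
    ∃ g : B →ₗ[R] Y, g ∘ₗ i = f := by
  obtain ⟨y, hy⟩ := Abelian.Ext.contravariant_sequence_exact₁
    (shortComplexOfExact_shortExact hi hip hp) _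
    (Abelian.Ext.mk₀ (ModuleCat.ofHom f)) (add_zero 1) (hC.eq_zero _)
  obtain ⟨g, rfl⟩ := Abelian.Ext.mk₀_bijective _ _ |>.surjective y
  rw [Abelian.Ext.mk₀_comp_mk₀] at hy
  have := Abelian.Ext.mk₀_bijective _ _ |>.injective hy
  exact ⟨g.hom, congrArg ModuleCat.Hom.hom this⟩

theorem ExtVanishes.one_of_exists_extension (hB : ExtVanishes R B Y 1)
    (h : ∀ f : A →ₗ[R] Y, ∃ g : B →ₗ[R] Y, g ∘ₗ i = f) : ExtVanishes R C Y 1 := by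
  refine .of_forall_eq_zero fun x ↦ ?_
  obtain ⟨y, rfl⟩ := Abelian.Ext.contravariant_sequence_exact₃
    (shortComplexOfExact_shortExact hi hip hp) _ x (hB.eq_zero _) (add_zero 1)
  obtain ⟨f, rfl⟩ := Abelian.Ext.mk₀_bijective _ _ |>.surjective y
  obtain ⟨g, hg⟩ := h f.hom
  have : f = (shortComplexOfExact hip).f ≫ ModuleCat.ofHom g := by
    ext1
    exact hg.symm
  rw [this, ← Abelian.Ext.mk₀_comp_mk₀, ← Abelian.Ext.comp_assoc_of_second_deg_zero,
    ShortComplex.ShortExact.extClass_comp, Abelian.Ext.zero_comp]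

theorem extVanishes_left_iff [Module.Projective R B] {k : ℕ} (hk : 0 < k) :
    ExtVanishes R A Y k ↔ ExtVanishes R C Y (k + 1) :=
  ⟨fun h ↦ .right hi hip hp h (.of_projective k.succ_pos),
    fun h ↦ .left hi hip hp (.of_projective hk) h⟩

end ExtVanishing

/-! ### Regular sequences and vanishing of Ext, second variable -/

section ExtSecondVariable

open scoped Pointwise

variable {R : Type u} [CommRing R]
  {A B C N : Type u} [AddCommGroup A] [Module R A] [AddCommGroup B] [Module R B]
  [AddCommGroup C] [Module R C] [AddCommGroup N] [Module R N]

theorem ExtVanishes.of_equiv (e : A ≃ₗ[R] B) {k : ℕ} (h : ExtVanishes R A N k) :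
    ExtVanishes R B N k := by
  refine .of_forall_eq_zero fun x ↦ ?_
  rw [← Abelian.Ext.mk₀_id_comp x,
    show 𝟙 (ModuleCat.of R B) = ModuleCat.ofHom e.symm.toLinearMap ≫ ModuleCat.ofHom e.toLinearMap
      by ext; simp, ← Abelian.Ext.mk₀_comp_mk₀, Abelian.Ext.comp_assoc_of_second_deg_zero,
    h.eq_zero ((Abelian.Ext.mk₀ (ModuleCat.ofHom e.toLinearMap)).comp x (zero_add k)),
    Abelian.Ext.comp_zero]

/-- If `f : A → A` is injective and induces zero on `Ext^{k+1}(N, A)`, then the vanishing of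
`Ext^k(N, coker f)` implies that of `Ext^{k+1}(N, A)`. -/
theorem ExtVanishes.of_coker {f : A →ₗ[R] A} {p : A →ₗ[R] C} (hf : Function.Injective f)
    (hfp : Function.Exact f p) (hp : Function.Surjective p) {k : ℕ} (hC : ExtVanishes R N C k)
    (h0 : ∀ x : Abelian.Ext (ModuleCat.of R N) (ModuleCat.of R A) (k + 1),
      x.comp (Abelian.Ext.mk₀ (ModuleCat.ofHom f)) (add_zero _) = 0) :
    ExtVanishes R N A (k + 1) := by
  refine .of_forall_eq_zero fun x ↦ ?_
  obtain ⟨y, rfl⟩ := Abelian.Ext.covariant_sequence_exact₁ _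
    (shortComplexOfExact_shortExact hf hfp hp) x (h0 x) rfl
  rw [hC.eq_zero y, Abelian.Ext.zero_comp]

/-- An element of J acts on Ext through either variable, and it acts as zero on N. The action of S
on A then extends this from J to JS. -/
theorem ext_comp_smul_eq_zero {J : Ideal R} (hN : ∀ j ∈ J, ∀ x : N, j • x = 0) (S : Type u)
    [CommRing S] [Algebra R S] [Module S A] [IsScalarTower R S A] {k : ℕ}
    (x : Abelian.Ext (ModuleCat.of R N) (ModuleCat.of R A) k) {r : S}
    (hr : r ∈ J.map (algebraMap R S)) :
    x.comp (Abelian.Ext.mk₀ (ModuleCat.ofHom (Algebra.lsmul R R A r))) (add_zero _) = 0 := by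
  induction hr using Submodule.span_induction with
  | mem r hr =>
    obtain ⟨j, hj, rfl⟩ := hr
    have h1 : ModuleCat.ofHom (Algebra.lsmul R R A (algebraMap R S j)) =
        j • 𝟙 (ModuleCat.of R A) := by
      ext a
      simp
    have h2 : j • 𝟙 (ModuleCat.of R N) = 0 := by
      ext a
      exact hN j hj a
    rw [h1, Abelian.Ext.mk₀_smul, Abelian.Ext.comp_smul, Abelian.Ext.comp_mk₀_id,
      ← Abelian.Ext.mk₀_id_comp x, ← Abelian.Ext.smul_comp, ← Abelian.Ext.mk₀_smul, h2]
    simp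
  | zero =>
    have h1 : ModuleCat.ofHom (Algebra.lsmul R R A (0 : S)) = 0 := by
      ext a
      simp
    rw [h1, Abelian.Ext.mk₀_zero, Abelian.Ext.comp_zero]
  | add r s _ _ h1 h2 =>
    rw [map_add, ModuleCat.ofHom_add, Abelian.Ext.mk₀_add, Abelian.Ext.comp_add, h1, h2, add_zero]
  | smul s r _ h =>
    have h1 : ModuleCat.ofHom (Algebra.lsmul R R A (s • r)) =
        ModuleCat.ofHom (Algebra.lsmul R R A r) ≫ ModuleCat.ofHom (Algebra.lsmul R R A s) := by
      ext a
      simp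
    rw [h1, ← Abelian.Ext.mk₀_comp_mk₀, ← Abelian.Ext.comp_assoc_of_third_deg_zero, h,
      Abelian.Ext.zero_comp]

/-- A module with a weakly regular sequence of length `k` in `JS` has `Ext^i(R/J, -) = 0` for
`i < k`. -/
theorem ExtVanishes.of_isWeaklyRegular {J : Ideal R} (hN : ∀ j ∈ J, ∀ x : N, j • x = 0)
    (S : Type u) [CommRing S] [Algebra R S] (rs : List S)
    (hrs : ∀ r ∈ rs, r ∈ J.map (algebraMap R S)) (M : Type u) [AddCommGroup M] [Module R M]
    [Module S M] [IsScalarTower R S M] (h : RingTheory.Sequence.IsWeaklyRegular M rs) {i : ℕ}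
    (hi : i < rs.length) : ExtVanishes R N M i := by
  induction rs generalizing M i with
  | nil => simp at hi
  | cons r rs ih =>
    rw [RingTheory.Sequence.isWeaklyRegular_cons_iff] at h
    have hr := hrs r (by simp)
    cases i with
    | zero =>
      rw [extVanishes_zero_iff]
      intro f
      have h0 := ext_comp_smul_eq_zero hN S (Abelian.Ext.mk₀ (ModuleCat.ofHom f)) hr
      rw [Abelian.Ext.mk₀_comp_mk₀, Abelian.Ext.mk₀_eq_zero_iff] at h0
      ext x
      apply h.1
      simpa using congrArg (fun g ↦ ModuleCat.Hom.hom g x) h0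
    | succ i =>
      have hC : ExtVanishes R N (QuotSMulTop r M) i :=
        ih (fun s hs ↦ hrs s (by simp [hs])) _ h.2 (by simpa using hi)
      -- The quotient map is S-linear by nature; here it is needed over R, where Ext is taken.
      let p : M →ₗ[R] QuotSMulTop r M :=
        { toFun := Submodule.Quotient.mk
          map_add' := fun _ _ ↦ rfl
          map_smul' := fun _ _ ↦ rfl }
      have hp : Function.Surjective p := fun y ↦ Submodule.Quotient.mk_surjective _ y
      have hfp : Function.Exact (Algebra.lsmul R R M r) p := by
        intro y
        change Submodule.Quotient.mk y = 0 ↔ ∃ z, r • z = y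
        simp [Submodule.Quotient.mk_eq_zero, Submodule.mem_smul_pointwise_iff_exists]
      exact .of_coker (f := Algebra.lsmul R R M r) h.1 hfp hp hC fun x ↦
        ext_comp_smul_eq_zero hN S x hr

end ExtSecondVariable

/-! ### Finitely presented modules over a coherent ring -/

section Coherent

variable {R : Type u} [CommRing R]

theorem finitePresentation_of_forall_fg_of_injective {L P : Type u} [AddCommGroup L] [Module R L]
    [AddCommGroup P] [Module R P] (hP : ∀ K : Submodule R P, K.FG → Module.FinitePresentation R K)
    [Module.Finite R L] (j : L →ₗ[R] P) (hj : Function.Injective j) :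
    Module.FinitePresentation R L := by
  have := hP (LinearMap.range j) (by
    rw [LinearMap.range_eq_map]; exact Module.Finite.fg_top.map j)
  exact .of_equiv (LinearEquiv.ofInjective j hj).symm

/-- Coherence passes to extensions: the image of L in Q is finitely presented, so the kernel of L →
f(L) is finitely generated inside ker f, hence finitely presented too. -/
theorem finitePresentation_of_fg_of_ker {P Q : Type u} [AddCommGroup P] [Module R P]
    [AddCommGroup Q] [Module R Q] (f : P →ₗ[R] Q)
    (hQ : ∀ K : Submodule R Q, K.FG → Module.FinitePresentation R K)
    (hf : ∀ K : Submodule R (LinearMap.ker f), K.FG → Module.FinitePresentation R K)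
    (L : Submodule R P) (hL : L.FG) : Module.FinitePresentation R L := by
  have : Module.Finite R L := .of_fg hL
  let g : L →ₗ[R] Q := f ∘ₗ L.subtype
  have : Module.FinitePresentation R (LinearMap.range g) :=
    hQ _ (by rw [LinearMap.range_eq_map]; exact Module.Finite.fg_top.map g)
  have hfin : (LinearMap.ker g.rangeRestrict).FG :=
    Module.FinitePresentation.fg_ker _ g.surjective_rangeRestrict
  have : Module.Finite R (LinearMap.ker g.rangeRestrict) := .of_fg hfin
  let j : LinearMap.ker g.rangeRestrict →ₗ[R] LinearMap.ker f :=
    LinearMap.codRestrict _ (L.subtype ∘ₗ Submodule.subtype _) (by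
      rintro ⟨x, hx⟩
      exact congrArg Subtype.val hx)
  have : Module.FinitePresentation R (LinearMap.ker g.rangeRestrict) :=
    finitePresentation_of_forall_fg_of_injective hf j (by
      intro x y hxy
      have h := congrArg Subtype.val hxy
      exact Subtype.ext (Subtype.ext h))
  exact Module.finitePresentation_of_ker g.rangeRestrict g.surjective_rangeRestrict

variable (hR : IsCoherentRing R)

include hR

theorem IsCoherentRing.finitePresentation_of_fg_pi (n : ℕ) (L : Submodule R (Fin n → R))
    (hL : L.FG) : Module.FinitePresentation R L := by
  induction n with
  | zero => infer_instance
  | succ n ih =>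
    let f : (Fin (n + 1) → R) →ₗ[R] R := LinearMap.proj 0
    refine finitePresentation_of_fg_of_ker f hR (fun K hK ↦ ?_) L hL
    have : Module.Finite R K := .of_fg hK
    refine finitePresentation_of_forall_fg_of_injective (L := K) ih
      (LinearMap.funLeft R R Fin.succ ∘ₗ (LinearMap.ker f).subtype ∘ₗ K.subtype) ?_
    rintro ⟨⟨x, hx⟩, _⟩ ⟨⟨y, hy⟩, _⟩ hxy
    refine Subtype.ext (Subtype.ext (funext fun i ↦ ?_))
    cases i using Fin.cases with
    | zero => exact (show x 0 = 0 from hx).trans (show y 0 = 0 from hy).symm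
    | succ i => exact congrFun hxy i

variable {L M N : Type u} [AddCommGroup L] [Module R L] [AddCommGroup M] [Module R M]
  [AddCommGroup N] [Module R N]

theorem IsCoherentRing.finitePresentation_of_fg [Module.FinitePresentation R M]
    (L : Submodule R M) (hL : L.FG) : Module.FinitePresentation R L := by
  obtain ⟨n, p, hp⟩ := Module.Finite.exists_fin' R M
  have hker : (LinearMap.ker p).FG := Module.FinitePresentation.fg_ker p hp
  have hfg : (L.comap p).FG := by
    refine Submodule.fg_of_fg_map_of_fg_inf_ker p ?_ ?_
    · rwa [Submodule.map_comap_eq_of_surjective hp]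
    · rwa [inf_eq_right.mpr (LinearMap.ker_le_comap p)]
  have := hR.finitePresentation_of_fg_pi n _ hfg
  let q : L.comap p →ₗ[R] L := p.restrict fun x hx ↦ hx
  refine Module.finitePresentation_of_surjective q ?_ ?_
  · rintro ⟨y, hy⟩
    obtain ⟨x, rfl⟩ := hp y
    exact ⟨⟨x, hy⟩, rfl⟩
  · have : (LinearMap.ker q).map (L.comap p).subtype = LinearMap.ker p := by
      ext x
      simp only [Submodule.mem_map, LinearMap.mem_ker, Submodule.coe_subtype]
      constructor
      · rintro ⟨y, hy, rfl⟩
        exact congrArg Subtype.val hy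
      · intro hx
        exact ⟨⟨x, by simp [hx]⟩, Subtype.ext hx, rfl⟩
    refine Submodule.fg_of_fg_map_injective _ (L.comap p).subtype_injective ?_
    rwa [this]

theorem IsCoherentRing.finitePresentation_ker [Module.FinitePresentation R M]
    [Module.FinitePresentation R N] (f : M →ₗ[R] N) :
    Module.FinitePresentation R (LinearMap.ker f) := by
  have : Module.FinitePresentation R (LinearMap.range f) :=
    hR.finitePresentation_of_fg _ (by
      rw [LinearMap.range_eq_map]; exact Module.Finite.fg_top.map f)
  have hfin : (LinearMap.ker f.rangeRestrict).FG :=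
    Module.FinitePresentation.fg_ker _ f.surjective_rangeRestrict
  rw [LinearMap.ker_rangeRestrict] at hfin
  exact hR.finitePresentation_of_fg _ hfin

theorem IsCoherentRing.finitePresentation_dual [Module.FinitePresentation R M] :
    Module.FinitePresentation R (Module.Dual R M) := by
  obtain ⟨n, m, f, g, hf, hfg⟩ := Module.FinitePresentation.exists_fin' R M
  let a : Module.Dual R M →ₗ[R] Module.Dual R (Fin n → R) := LinearMap.lcomp R R f
  let b : Module.Dual R (Fin n → R) →ₗ[R] Module.Dual R (Fin m → R) := LinearMap.lcomp R R g
  have hab : Function.Exact a b := LinearMap.exact_lcomp_of_exact_of_surjective _ hfg hf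
  have ha : Function.Injective a := LinearMap.lcomp_injective_of_surjective f hf
  have : Module.FinitePresentation R (Module.Dual R (Fin n → R)) :=
    Module.finitePresentation_of_projective R _
  have : Module.FinitePresentation R (Module.Dual R (Fin m → R)) :=
    Module.finitePresentation_of_projective R _
  have := hR.finitePresentation_ker b
  let e : LinearMap.ker b ≃ₗ[R] Module.Dual R M :=
    (LinearEquiv.ofEq _ _ hab.linearMap_ker_eq).trans (LinearEquiv.ofInjective a ha).symm
  exact Module.FinitePresentation.of_equiv (M := LinearMap.ker b) e

/-- Over a coherent ring, the vanishing of `Ext` on cyclic finitely presented modules implies its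
vanishing on all finitely presented modules. -/
theorem IsCoherentRing.extVanishes_of_cyclic {k : ℕ} (hk : 0 < k)
    (h : ∀ I : Ideal R, I.FG → ExtVanishes R (R ⧸ I) M k) [hN : Module.FinitePresentation R N] :
    ExtVanishes R N M k := by
  obtain ⟨n, s, hs⟩ := Module.Finite.exists_fin (R := R) (M := N)
  induction n generalizing N with
  | zero =>
    have : Subsingleton N := by
      rw [← Submodule.subsingleton_iff R, ← subsingleton_iff_bot_eq_top, ← hs]
      simp
    exact .of_projective hk
  | succ n ih =>
    -- Split off the cyclic submodule spanned by the first generator; the quotient needs one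
    -- generator fewer.
    let t : R →ₗ[R] N := LinearMap.toSpanSingleton R N (s 0)
    have hfg : (LinearMap.range t).FG := by
      rw [LinearMap.range_eq_map]; exact Module.Finite.fg_top.map t
    have : Module.FinitePresentation R (LinearMap.range t) := hR.finitePresentation_of_fg _ hfg
    have h1 : (LinearMap.ker t).FG := by
      have := Module.FinitePresentation.fg_ker t.rangeRestrict t.surjective_rangeRestrict
      rwa [LinearMap.ker_rangeRestrict] at this
    have h2 : ExtVanishes R (LinearMap.range t) M k :=
      .of_equiv t.quotKerEquivRange (h _ h1)
    have : Module.FinitePresentation R (N ⧸ LinearMap.range t) :=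
      Module.finitePresentation_of_surjective _ (Submodule.mkQ_surjective _)
        (by rwa [Submodule.ker_mkQ])
    have h3 : ExtVanishes R (N ⧸ LinearMap.range t) M k := by
      refine ih (fun i ↦ (LinearMap.range t).mkQ (s i.succ)) ?_
      rw [eq_top_iff, ← (LinearMap.range t).range_mkQ, LinearMap.range_eq_map (Submodule.mkQ _),
        ← hs, Submodule.map_span, Submodule.span_le]
      rintro _ ⟨_, ⟨i, rfl⟩, rfl⟩
      cases i using Fin.cases with
      | zero =>
        have : (LinearMap.range t).mkQ (s 0) = 0 := by
          simpa using ⟨1, by simp [t]⟩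
        rw [this]
        exact zero_mem _
      | succ i => exact Submodule.subset_span ⟨i, rfl⟩
    exact .middle (Submodule.subtype_injective _) (LinearMap.exact_subtype_mkQ _)
      (Submodule.mkQ_surjective _) h2 h3

end Coherent

/-! ### Totally reflexive modules -/

section TotallyReflexive

variable (R : Type u) [CommRing R]

/-- The conditions defining the G-class, without finite generation. -/
structure IsTotallyReflexive (M : Type u) [AddCommGroup M] [Module R M] : Prop where
  ext_vanishes : ∀ i : ℕ, 0 < i → ExtVanishes R M R i
  ext_dual_vanishes : ∀ i : ℕ, 0 < i → ExtVanishes R (Module.Dual R M) R i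
  bijective_eval : Function.Bijective (Module.Dual.eval R M)

variable {R}
variable {A B C : Type u} [AddCommGroup A] [Module R A] [AddCommGroup B] [Module R B]
  [AddCommGroup C] [Module R C]

theorem IsTotallyReflexive.of_finite_projective [Module.Finite R A] [Module.Projective R A] :
    IsTotallyReflexive R A where
  ext_vanishes _ hi := .of_projective hi
  ext_dual_vanishes _ hi := .of_projective hi
  bijective_eval := Module.bijective_dual_eval R A

theorem IsTotallyReflexive.dual (h : IsTotallyReflexive R A) :
    IsTotallyReflexive R (Module.Dual R A) where
  ext_vanishes := h.ext_dual_vanishes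
  ext_dual_vanishes i hi :=
    .of_equiv (LinearEquiv.ofBijective _ h.bijective_eval) (h.ext_vanishes i hi)
  bijective_eval := by
    constructor
    · intro f g hfg
      ext a
      exact LinearMap.congr_fun hfg (Module.Dual.eval R A a)
    · intro φ
      refine ⟨φ ∘ₗ Module.Dual.eval R A, ?_⟩
      ext ψ
      obtain ⟨a, rfl⟩ := h.bijective_eval.surjective ψ
      rfl

variable {i : A →ₗ[R] B} {p : B →ₗ[R] C}

theorem exact_dualMap (hip : Function.Exact i p) (hp : Function.Surjective p) :
    Function.Exact p.dualMap i.dualMap :=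
  LinearMap.exact_lcomp_of_exact_of_surjective _ hip hp

variable (hi : Function.Injective i) (hip : Function.Exact i p) (hp : Function.Surjective p)

include hi hip hp

theorem ExtVanishes.dualMap_surjective (hC : ExtVanishes R C R 1) :
    Function.Surjective i.dualMap :=
  fun f ↦ hC.exists_extension hi hip hp f

/-- As Ext^1(C, R) = 0, the dual sequence 0 → C* → B* → A* → 0 is exact; the rest is its long exact
sequence and a diagram chase with biduality. -/
theorem IsTotallyReflexive.left (hB : IsTotallyReflexive R B) (hC : IsTotallyReflexive R C) :
    IsTotallyReflexive R A := by
  have hs := (hC.ext_vanishes 1 one_pos).dualMap_surjective hi hip hp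
  have hpi := LinearMap.dualMap_injective_of_surjective hp
  have hex := exact_dualMap hip hp
  refine ⟨fun k hk ↦ .left hi hip hp (hB.ext_vanishes k hk) (hC.ext_vanishes _ k.succ_pos),
    fun k hk ↦ ?_, ?_, ?_⟩
  · obtain ⟨k, rfl⟩ := Nat.exists_eq_add_of_lt hk
    rw [zero_add]
    rcases Nat.eq_zero_or_pos k with rfl | hk'
    -- In degree 1 the long exact sequence involves Hom(C*, R), which need not vanish. But a
    -- functional on C* is evaluation at some c = p b, and evaluation at b extends it to B*.
    · refine .one_of_exists_extension hpi hex hs (hB.ext_dual_vanishes 1 one_pos) fun f ↦ ?_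
      obtain ⟨c, rfl⟩ := hC.bijective_eval.surjective f
      obtain ⟨b, rfl⟩ := hp c
      exact ⟨Module.Dual.eval R B b, rfl⟩
    · exact .right hpi hex hs (hC.ext_dual_vanishes k hk') (hB.ext_dual_vanishes _ k.succ_pos)
  · rw [injective_iff_map_eq_zero]
    intro a ha
    refine (injective_iff_map_eq_zero i).mp hi a
      ((injective_iff_map_eq_zero _).mp hB.bijective_eval.injective _ ?_)
    ext f
    exact LinearMap.congr_fun ha (i.dualMap f)
  · intro φ
    obtain ⟨b, hb⟩ := hB.bijective_eval.surjective (φ ∘ₗ i.dualMap)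
    have hb' (f : Module.Dual R B) : f b = φ (i.dualMap f) := LinearMap.congr_fun hb f
    have : p b = 0 := by
      refine (injective_iff_map_eq_zero _).mp hC.bijective_eval.injective _ ?_
      ext g
      have := hb' (p.dualMap g)
      rw [hex.apply_apply_eq_zero, map_zero] at this
      exact this
    obtain ⟨a, rfl⟩ := (hip b).mp this
    refine ⟨a, ?_⟩
    ext f
    obtain ⟨g, rfl⟩ := hs f
    exact hb' g

theorem IsTotallyReflexive.middle (hA : IsTotallyReflexive R A) (hC : IsTotallyReflexive R C) :
    IsTotallyReflexive R B := by
  have hs := (hC.ext_vanishes 1 one_pos).dualMap_surjective hi hip hp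
  have hpi := LinearMap.dualMap_injective_of_surjective hp
  have hex := exact_dualMap hip hp
  refine ⟨fun k hk ↦ .middle hi hip hp (hA.ext_vanishes k hk) (hC.ext_vanishes k hk),
    fun k hk ↦ .middle hpi hex hs (hC.ext_dual_vanishes k hk) (hA.ext_dual_vanishes k hk), ?_, ?_⟩
  · rw [injective_iff_map_eq_zero]
    intro b hb
    have : p b = 0 := by
      refine (injective_iff_map_eq_zero _).mp hC.bijective_eval.injective _ ?_
      ext g
      exact LinearMap.congr_fun hb (p.dualMap g)
    obtain ⟨a, rfl⟩ := (hip b).mp this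
    rw [(injective_iff_map_eq_zero _).mp hA.bijective_eval.injective a, map_zero]
    ext f
    obtain ⟨g, rfl⟩ := hs f
    exact LinearMap.congr_fun hb g
  · intro φ
    obtain ⟨c, hc⟩ := hC.bijective_eval.surjective (φ ∘ₗ p.dualMap)
    obtain ⟨b, rfl⟩ := hp c
    obtain ⟨ψ, hψ⟩ := (exact_dualMap hex hs (φ - Module.Dual.eval R B b)).mp (by
      ext g
      exact sub_eq_zero.mpr (LinearMap.congr_fun hc g).symm)
    obtain ⟨a, rfl⟩ := hA.bijective_eval.surjective ψ
    refine ⟨b + i a, ?_⟩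
    rw [map_add, add_comm, ← eq_sub_iff_add_eq, ← hψ]
    rfl

omit hi hip hp in
theorem IsTotallyReflexive.of_equiv (e : A ≃ₗ[R] B) (h : IsTotallyReflexive R A) :
    IsTotallyReflexive R B :=
  .middle (i := e.toLinearMap) (p := (0 : B →ₗ[R] PUnit.{u + 1})) e.injective
    (fun b ↦ ⟨fun _ ↦ e.surjective b, fun _ ↦ rfl⟩) (fun _ ↦ ⟨0, rfl⟩) h .of_finite_projective

end TotallyReflexive

/-! ### Finite resolutions and their syzygies -/

section Resolutions

variable (R : Type u) [CommRing R]

/-- `M` has a resolution of length `k` by modules with the property `Q`, the last of which has the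
property `P`. -/
def HasResolution (P Q : ∀ (M : Type u) [AddCommGroup M] [Module R M], Prop) :
    ℕ → ∀ (M : Type u) [AddCommGroup M] [Module R M], Prop
  | 0, M, _, _ => P M
  | k + 1, M, _, _ => ∃ (K F : Type u) (_ : AddCommGroup K) (_ : Module R K) (_ : AddCommGroup F)
      (_ : Module R F) (i : K →ₗ[R] F) (p : F →ₗ[R] M), Function.Injective i ∧
      Function.Exact i p ∧ Function.Surjective p ∧ Q F ∧ HasResolution P Q k K

/-- `M` has a resolution of length `k` by totally reflexive modules. -/
abbrev GDimLE := HasResolution R (fun M ↦ IsTotallyReflexive R M) (fun M ↦ IsTotallyReflexive R M)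

/-- Finite free modules. -/
def IsFiniteFree (M : Type u) [AddCommGroup M] [Module R M] : Prop :=
  Module.Free R M ∧ Module.Finite R M

/-- Finitely presented totally reflexive modules. -/
def IsFPTotallyReflexive (M : Type u) [AddCommGroup M] [Module R M] : Prop :=
  Module.FinitePresentation R M ∧ IsTotallyReflexive R M

/-- The `k`-th syzygy of `M` in some resolution by finite free modules is finitely presented and
totally reflexive. -/
abbrev HasReflexiveSyzygy := HasResolution R (fun M ↦ IsFPTotallyReflexive R M)
  (fun M ↦ IsFiniteFree R M)

/-- `M` has a resolution of length `k` by finite free modules. -/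
abbrev HasFreeResolution := HasResolution R (fun M ↦ IsFiniteFree R M)
  (fun M ↦ IsFiniteFree R M)

variable {R}

theorem HasFreeResolution.extVanishes {k : ℕ} {M Y : Type u} [AddCommGroup M] [Module R M]
    [AddCommGroup Y] [Module R Y] (h : HasFreeResolution R k M) {j : ℕ} (hj : k < j) :
    ExtVanishes R M Y j := by
  induction k generalizing M j with
  | zero =>
    obtain ⟨_, _⟩ := h
    exact .of_projective hj
  | succ k ih =>
    obtain ⟨K, F, _, _, _, _, i, p, hi, hip, hp, ⟨_, _⟩, hK⟩ := h
    obtain ⟨j, rfl⟩ := Nat.exists_eq_add_of_lt (Nat.zero_lt_of_lt hj)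
    rw [zero_add] at hj ⊢
    exact .right hi hip hp (ih hK (Nat.lt_of_succ_lt_succ hj)) (.of_projective j.succ_pos)

variable {A B C : Type u} [AddCommGroup A] [Module R A] [AddCommGroup B] [Module R B]
  [AddCommGroup C] [Module R C] {i : A →ₗ[R] B} {p : B →ₗ[R] C}

/-- If H → B starts a resolution of B, the preimage of A in H is the kernel of H → C, hence totally
reflexive, and the syzygy Y is unchanged. -/
theorem GDimLE.left (hi : Function.Injective i) (hip : Function.Exact i p)
    (hp : Function.Surjective p) {k : ℕ} (hB : GDimLE R k B) (hC : IsTotallyReflexive R C) :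
    GDimLE R k A := by
  cases k with
  | zero => exact IsTotallyReflexive.left hi hip hp hB hC
  | succ k =>
    obtain ⟨Y, H, _, _, _, _, j, q, hj, hjq, hq, hH, hY⟩ := hB
    have hmem (x : LinearMap.ker (p ∘ₗ q)) :
        (q ∘ₗ (LinearMap.ker (p ∘ₗ q)).subtype) x ∈ LinearMap.range i := (hip _).mp x.2
    refine ⟨Y, LinearMap.ker (p ∘ₗ q), _, _, _, _,
      j.codRestrict _ (fun y ↦ by simp [hjq.apply_apply_eq_zero]),
      LinearMap.codRestrictOfInjective _ i hi hmem, ?_, ?_, ?_,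
      .left (Submodule.subtype_injective _) (LinearMap.exact_subtype_ker_map _)
        (hp.comp hq) hH hC, hY⟩
    · intro x y hxy
      exact hj (congrArg Subtype.val hxy)
    · rintro ⟨x, hx⟩
      rw [← map_eq_zero_iff i hi, ← LinearMap.comp_apply,
        LinearMap.codRestrictOfInjective_comp]
      exact (hjq x).trans ⟨fun ⟨y, hy⟩ ↦ ⟨y, Subtype.ext hy⟩,
        fun ⟨y, hy⟩ ↦ ⟨y, congrArg Subtype.val hy⟩⟩
    · intro a
      obtain ⟨x, hx⟩ := hq (i a)
      refine ⟨⟨x, ?_⟩, hi ?_⟩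
      · simp [hx, hip.apply_apply_eq_zero]
      · rw [← LinearMap.comp_apply, LinearMap.codRestrictOfInjective_comp]
        exact hx

/-- Horseshoe argument: C splits off, so H × C covers B with the same syzygy Y. -/
theorem GDimLE.middle (hi : Function.Injective i) (hip : Function.Exact i p)
    (hp : Function.Surjective p) {k : ℕ} (hA : GDimLE R k A) [Module.Finite R C]
    [Module.Projective R C] : GDimLE R k B := by
  cases k with
  | zero => exact IsTotallyReflexive.middle hi hip hp hA .of_finite_projective
  | succ k =>
    obtain ⟨Y, H, _, _, _, _, j, q, hj, hjq, hq, hH, hY⟩ := hA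
    obtain ⟨s, hs⟩ := Module.projective_lifting_property p LinearMap.id hp
    have hs' (c : C) : p (s c) = c := LinearMap.congr_fun hs c
    refine ⟨Y, H × C, _, _, _, _, LinearMap.inl R H C ∘ₗ j, (i ∘ₗ q).coprod s, ?_, ?_, ?_,
      .middle LinearMap.inl_injective (.inl_snd) LinearMap.snd_surjective hH .of_finite_projective,
      hY⟩
    · exact LinearMap.inl_injective.comp hj
    · rintro ⟨h, c⟩
      simp only [LinearMap.coprod_apply, LinearMap.comp_apply, LinearMap.inl_apply, Set.mem_range,
        Prod.mk.injEq]
      constructor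
      · intro h0
        have hc : c = 0 := by
          simpa [hip.apply_apply_eq_zero, hs'] using congrArg p h0
        subst hc
        rw [map_zero, add_zero, map_eq_zero_iff i hi] at h0
        obtain ⟨y, rfl⟩ := (hjq h).mp h0
        exact ⟨y, rfl, rfl⟩
      · rintro ⟨y, rfl, rfl⟩
        simp [hjq.apply_apply_eq_zero]
    · intro b
      obtain ⟨a, ha⟩ := (hip (b - s (p b))).mp (by simp [hs'])
      obtain ⟨h, rfl⟩ := hq a
      exact ⟨(h, p b), by simp [ha]⟩

/-- Schanuel's argument: the fibre product X of H and B over C is an extension of B by Y and also an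
extension of H by A. The first bounds X, the second then bounds A. -/
theorem GDimLE.syzygy (hi : Function.Injective i) (hip : Function.Exact i p)
    (hp : Function.Surjective p) [Module.Finite R B] [Module.Projective R B] {k : ℕ}
    (hC : GDimLE R (k + 1) C) : GDimLE R k A := by
  obtain ⟨Y, H, _, _, _, _, j, q, hj, hjq, hq, hH, hY⟩ := hC
  let X := LinearMap.ker (q.coprod (-p))
  have hX (h : H) (b : B) : (h, b) ∈ X ↔ q h = p b := by
    simp [X, ← sub_eq_add_neg, sub_eq_zero]
  have hXk : GDimLE R k X := by
    refine .middle (i := (LinearMap.inl R H B ∘ₗ j).codRestrict X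
      fun y ↦ (hX _ _).mpr (by simp [hjq.apply_apply_eq_zero]))
      (p := LinearMap.snd R H B ∘ₗ X.subtype) ?_ ?_ ?_ hY
    · intro x y hxy
      exact hj (congrArg (fun z ↦ (Subtype.val z).1) hxy)
    · rintro ⟨⟨h, b⟩, hx⟩
      rw [hX] at hx
      constructor
      · rintro (rfl : b = 0)
        obtain ⟨y, rfl⟩ := (hjq h).mp (by rw [hx, map_zero])
        exact ⟨y, rfl⟩
      · rintro ⟨y, hy⟩
        exact (congrArg (fun z ↦ (Subtype.val z).2) hy).symm
    · intro b
      obtain ⟨h, hh⟩ := hq (p b)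
      exact ⟨⟨(h, b), (hX _ _).mpr hh⟩, rfl⟩
  refine .left (i := (LinearMap.inr R H B ∘ₗ i).codRestrict X
    fun a ↦ (hX _ _).mpr (by simp [hip.apply_apply_eq_zero]))
    (p := LinearMap.fst R H B ∘ₗ X.subtype) ?_ ?_ ?_ hXk hH
  · intro x y hxy
    exact hi (congrArg (fun z ↦ (Subtype.val z).2) hxy)
  · rintro ⟨⟨h, b⟩, hx⟩
    rw [hX] at hx
    constructor
    · rintro (rfl : h = 0)
      obtain ⟨y, rfl⟩ := (hip b).mp (by rw [← hx, map_zero])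
      exact ⟨y, rfl⟩
    · rintro ⟨y, hy⟩
      exact (congrArg (fun z ↦ (Subtype.val z).1) hy).symm
  · intro h
    obtain ⟨b, hb⟩ := hp (q h)
    exact ⟨⟨(h, b), (hX _ _).mpr hb.symm⟩, rfl⟩

end Resolutions

/-! ### Approximation by modules with finite free resolutions -/

section Approximation

variable {R : Type u} [CommRing R] (hR : IsCoherentRing R)
  {M : Type u} [AddCommGroup M] [Module R M]

include hR

theorem HasReflexiveSyzygy.of_gDimLE [Module.FinitePresentation R M] {k : ℕ}
    (h : GDimLE R k M) : HasReflexiveSyzygy R k M := by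
  induction k generalizing M with
  | zero => exact ⟨inferInstance, h⟩
  | succ k ih =>
    obtain ⟨n, p, hp⟩ := Module.Finite.exists_fin' R M
    have hex := LinearMap.exact_subtype_ker_map p
    have := hR.finitePresentation_ker p
    exact ⟨LinearMap.ker p, Fin n → R, _, _, _, _, (LinearMap.ker p).subtype, p,
      Submodule.subtype_injective _, hex, hp, ⟨inferInstance, inferInstance⟩,
      ih (h.syzygy (Submodule.subtype_injective _) hex hp)⟩

/-- Dualize a finite free cover q of M*: M ≅ M** embeds in a finite free module with cokernel (ker
q)*. -/
theorem IsFPTotallyReflexive.exists_embedding (h : IsFPTotallyReflexive R M) :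
    ∃ (P C : Type u) (_ : AddCommGroup P) (_ : Module R P) (_ : AddCommGroup C) (_ : Module R C)
      (i : M →ₗ[R] P) (p : P →ₗ[R] C), Function.Injective i ∧ Function.Exact i p ∧
      Function.Surjective p ∧ IsFiniteFree R P ∧ IsFPTotallyReflexive R C := by
  obtain ⟨_, h⟩ := h
  have := hR.finitePresentation_dual (M := M)
  obtain ⟨n, q, hq⟩ := Module.Finite.exists_fin' R (Module.Dual R M)
  have hj := Submodule.subtype_injective (LinearMap.ker q)
  have hjq := LinearMap.exact_subtype_ker_map q
  have := hR.finitePresentation_ker q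
  have hL : IsTotallyReflexive R (LinearMap.ker q) := .left hj hjq hq .of_finite_projective h.dual
  refine ⟨Module.Dual R (Fin n → R), Module.Dual R (LinearMap.ker q), _, _, _, _,
    q.dualMap ∘ₗ Module.Dual.eval R M, (LinearMap.ker q).subtype.dualMap, ?_, ?_,
    h.dual.ext_vanishes 1 one_pos |>.dualMap_surjective hj hjq hq,
    ⟨inferInstance, inferInstance⟩, hR.finitePresentation_dual, hL.dual⟩
  · exact (LinearMap.dualMap_injective_of_surjective hq).comp h.bijective_eval.injective
  · intro x
    rw [exact_dualMap hjq hq x, LinearMap.coe_comp, h.bijective_eval.surjective.range_comp]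

/-- A module with a finitely presented totally reflexive `k`-th syzygy embeds into a module with a
finite free resolution of length `k`, with finitely presented totally reflexive cokernel. -/
theorem HasReflexiveSyzygy.exists_approximation {k : ℕ} (h : HasReflexiveSyzygy R k M) :
    ∃ (W C : Type u) (_ : AddCommGroup W) (_ : Module R W) (_ : AddCommGroup C) (_ : Module R C)
      (i : M →ₗ[R] W) (p : W →ₗ[R] C), Function.Injective i ∧ Function.Exact i p ∧
      Function.Surjective p ∧ HasFreeResolution R k W ∧ IsFPTotallyReflexive R C := by
  induction k generalizing M with
  | zero => exact IsFPTotallyReflexive.exists_embedding hR h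
  | succ k ih =>
    obtain ⟨K, F, _, _, _, _, i, p, hi, hip, hp, ⟨_, _⟩, hK⟩ := h
    obtain ⟨V, D, _, _, _, _, a, b, ha, hab, hb, hV, hD⟩ := ih hK
    obtain ⟨_, hD⟩ := hD
    -- Since Ext^1(D, R) = 0 and F is finite free, i extends to V coordinate by coordinate.
    obtain ⟨g, hg⟩ : ∃ g : V →ₗ[R] F, g ∘ₗ a = i := by
      let e := (Module.Free.chooseBasis R F).equivFun
      choose g hg using fun l ↦ (hD.ext_vanishes 1 one_pos).exists_extension ha hab hb
        (LinearMap.proj l ∘ₗ e.toLinearMap ∘ₗ i)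
      refine ⟨e.symm.toLinearMap ∘ₗ LinearMap.pi g, ?_⟩
      ext x
      refine e.injective (funext fun l ↦ ?_)
      simpa using LinearMap.congr_fun (hg l) x
    have hg' (x : K) : g (a x) = i x := LinearMap.congr_fun hg x
    -- F × D is the pushout of F and V over K, split by g. Embedding it in a free P, put W = P/V:
    -- inside P the intersection of F and V is K, so M = F/K embeds in W, with cokernel P/(F + V) =
    -- P/(F × D) = C.
    have hX : IsFPTotallyReflexive R (F × D) := by
      have : Module.FinitePresentation R F := Module.finitePresentation_of_projective R F
      exact ⟨inferInstance, .middle LinearMap.inl_injective .inl_snd LinearMap.snd_surjective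
        .of_finite_projective hD⟩
    obtain ⟨P, C, _, _, _, _, e, q, he, heq, hq, hP, hC⟩ := hX.exists_embedding hR
    have he' (x : F × D) : q (e x) = 0 := heq.apply_apply_eq_zero x
    have hgb (v : V) : g.prod b v = (g v, b v) := rfl
    let j : V →ₗ[R] P := e ∘ₗ g.prod b
    have hj : Function.Injective j := by
      refine he.comp ((injective_iff_map_eq_zero (g.prod b)).mpr fun v hv ↦ ?_)
      rw [hgb, Prod.mk_eq_zero] at hv
      obtain ⟨x, rfl⟩ := (hab v).mp hv.2
      rw [hg', map_eq_zero_iff i hi] at hv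
      rw [hv.1, map_zero]
    let r : F →ₗ[R] P ⧸ LinearMap.range j :=
      (LinearMap.range j).mkQ ∘ₗ e ∘ₗ LinearMap.inl R F D
    have hr (x : F) : r x = 0 ↔ p x = 0 := by
      rw [hip x]
      simp only [r, LinearMap.comp_apply, Submodule.mkQ_apply, Submodule.Quotient.mk_eq_zero,
        LinearMap.mem_range, j, he.eq_iff, LinearMap.inl_apply, hgb, Prod.mk.injEq, Set.mem_range]
      constructor
      · rintro ⟨v, rfl, hv⟩
        obtain ⟨y, rfl⟩ := (hab v).mp hv
        exact ⟨y, (hg' y).symm⟩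
      · rintro ⟨y, rfl⟩
        exact ⟨a y, hg' y, hab.apply_apply_eq_zero y⟩
    let s : M ≃ₗ[R] F ⧸ LinearMap.ker p := (p.quotKerEquivOfSurjective hp).symm
    have hs (x : F) : s (p x) = Submodule.Quotient.mk x := by
      rw [LinearEquiv.symm_apply_eq]
      rfl
    let c : M →ₗ[R] P ⧸ LinearMap.range j :=
      (LinearMap.ker p).liftQ r (fun x hx ↦ (hr x).mpr hx) ∘ₗ s.toLinearMap
    have hc (x : F) : c (p x) = r x := by
      simp only [c, LinearMap.comp_apply, LinearEquiv.coe_coe, hs]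
      exact Submodule.liftQ_apply _ r x
    let d : P ⧸ LinearMap.range j →ₗ[R] C := (LinearMap.range j).liftQ q (by
      rintro _ ⟨v, rfl⟩
      exact he' _)
    have hd (x : P) : d ((LinearMap.range j).mkQ x) = q x := rfl
    refine ⟨P ⧸ LinearMap.range j, C, _, _, _, _, c, d, ?_, ?_, ?_,
      ⟨V, P, _, _, _, _, j, (LinearMap.range j).mkQ, hj, LinearMap.exact_map_mkQ_range j,
        Submodule.mkQ_surjective _, hP, hV⟩, hC⟩
    · rw [injective_iff_map_eq_zero]
      intro m hm
      obtain ⟨x, rfl⟩ := hp m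
      rwa [hc, hr] at hm
    · intro y
      obtain ⟨y, rfl⟩ := Submodule.mkQ_surjective _ y
      rw [hd]
      constructor
      · intro hy
        obtain ⟨⟨f, t⟩, rfl⟩ := (heq y).mp hy
        obtain ⟨v, rfl⟩ := hb t
        refine ⟨p (f - g v), ?_⟩
        rw [hc, ← sub_eq_zero, LinearMap.comp_apply, ← map_sub, Submodule.mkQ_apply,
          Submodule.Quotient.mk_eq_zero]
        refine ⟨-v, ?_⟩
        simp only [j, LinearMap.comp_apply, ← map_sub]
        congr 1
        simp
      · rintro ⟨m, hm⟩
        obtain ⟨x, rfl⟩ := hp m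
        rw [hc] at hm
        rw [← hd, ← hm]
        exact he' _
    · intro z
      obtain ⟨x, rfl⟩ := hq z
      exact ⟨(LinearMap.range j).mkQ x, rfl⟩

end Approximation

/-! ### Comparison with G-resolutions -/

section GResolutions

variable {R : Type u} [CommRing R] {M : Type u} [AddCommGroup M] [Module R M]

theorem GClass.isTotallyReflexive (h : GClass R M) : IsTotallyReflexive R M :=
  ⟨h.ext_vanishes, h.ext_dual_vanishes, h.bijective_eval⟩

theorem IsTotallyReflexive.gClass [Module.Finite R M] (h : IsTotallyReflexive R M) : GClass R M :=
  ⟨inferInstance, h.ext_vanishes, h.ext_dual_vanishes, h.bijective_eval⟩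

/-- The G-resolution of the first syzygy obtained from a G-resolution. -/
def GResolution.tail (P : GResolution R M) : GResolution R (LinearMap.ker P.ε) where
  G n := P.G (n + 1)
  d n := P.d (n + 1)
  ε := (P.d 0).codRestrict _ P.exact_ε.apply_apply_eq_zero
  gClass n := P.gClass (n + 1)
  exact_d n := P.exact_d (n + 1)
  exact_ε x := by
    rw [← P.exact_d 0 x]
    exact Subtype.ext_iff
  surjective_ε := by
    rintro ⟨x, hx⟩
    obtain ⟨y, rfl⟩ := (P.exact_ε x).mp hx
    exact ⟨y, rfl⟩

theorem GResolution.gDimLE (P : GResolution R M) {k : ℕ}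
    (hP : ∀ n, k < n → Subsingleton (P.G n)) : GDimLE R k M := by
  induction k generalizing M with
  | zero =>
    have := hP 1 one_pos
    refine (P.gClass 0).isTotallyReflexive.of_equiv (LinearEquiv.ofBijective P.ε
      ⟨(injective_iff_map_eq_zero _).mpr fun x hx ↦ ?_, P.surjective_ε⟩)
    obtain ⟨y, rfl⟩ := (P.exact_ε x).mp hx
    rw [Subsingleton.elim y 0, map_zero]
  | succ k ih =>
    exact ⟨LinearMap.ker P.ε, P.G 0, _, _, _, _, (LinearMap.ker P.ε).subtype, P.ε,
      Submodule.subtype_injective _, LinearMap.exact_subtype_ker_map _, P.surjective_ε,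
      (P.gClass 0).isTotallyReflexive, ih P.tail fun n hn ↦ hP (n + 1) (Nat.succ_lt_succ hn)⟩

theorem exists_gDimLE_of_gDim_lt_top (h : gDim R M < ⊤) : ∃ k, GDimLE R k M := by
  obtain ⟨P, hP⟩ := iInf_lt_iff.mp h
  obtain ⟨k, hk⟩ := ENat.ne_top_iff_exists.mp hP.ne
  refine ⟨k, P.gDimLE fun n hn ↦ ?_⟩
  by_contra hn'
  rw [not_subsingleton_iff_nontrivial] at hn'
  have : (n : ℕ∞) ≤ k := hk ▸ le_sSup ⟨n, rfl, hn'⟩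
  exact absurd (Nat.cast_le.mp this) (not_le.mpr hn)

/-- A module in the G-class is its own G-resolution. -/
noncomputable def GResolution.single (h : GClass R M) : GResolution R M where
  G n := match n with
    | 0 => ModuleCat.of R M
    | _ + 1 => ModuleCat.of R PUnit
  d _ := 0
  ε := LinearMap.id
  gClass n := match n with
    | 0 => h
    | _ + 1 => IsTotallyReflexive.gClass (M := PUnit.{u + 1}) .of_finite_projective
  exact_d _ _ := ⟨fun _ ↦ ⟨0, rfl⟩, fun _ ↦ rfl⟩
  exact_ε _ := ⟨fun h ↦ ⟨0, h.symm⟩, fun ⟨_, h⟩ ↦ h.symm⟩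
  surjective_ε := Function.surjective_id

/-- Splicing a short exact sequence with a G-resolution of its kernel. -/
noncomputable def GResolution.cons {K F : Type u} [AddCommGroup K] [Module R K] [AddCommGroup F]
    [Module R F] {i : K →ₗ[R] F} {p : F →ₗ[R] M} (hi : Function.Injective i)
    (hip : Function.Exact i p) (hp : Function.Surjective p) (hF : GClass R F)
    (P : GResolution R K) : GResolution R M where
  G n := match n with
    | 0 => ModuleCat.of R F
    | n + 1 => P.G n
  d n := match n with
    | 0 => i ∘ₗ P.ε
    | n + 1 => P.d n
  ε := p
  gClass n := match n with
    | 0 => hF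
    | n + 1 => P.gClass n
  exact_d n := match n with
    | 0 => fun x ↦ by
      rw [← P.exact_ε x]
      exact map_eq_zero_iff i hi
    | n + 1 => P.exact_d n
  exact_ε x := by
    rw [hip x]
    exact Set.ext_iff.mp (P.surjective_ε.range_comp i).symm x
  surjective_ε := hp

theorem HasReflexiveSyzygy.exists_gResolution {k : ℕ} (h : HasReflexiveSyzygy R k M) :
    ∃ P : GResolution R M, ∀ n, k < n → Subsingleton (P.G n) := by
  induction k generalizing M with
  | zero =>
    obtain ⟨_, h⟩ := h
    refine ⟨.single h.gClass, fun n hn ↦ ?_⟩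
    cases n with
    | zero => exact absurd hn (lt_irrefl 0)
    | succ n => exact inferInstanceAs (Subsingleton PUnit)
  | succ k ih =>
    obtain ⟨K, F, _, _, _, _, i, p, hi, hip, hp, ⟨_, _⟩, hK⟩ := h
    obtain ⟨P, hP⟩ := ih hK
    refine ⟨.cons hi hip hp (IsTotallyReflexive.gClass .of_finite_projective) P, fun n hn ↦ ?_⟩
    cases n with
    | zero => exact absurd hn (Nat.not_lt_zero _)
    | succ n => exact hP n (Nat.lt_of_succ_lt_succ hn)

theorem HasReflexiveSyzygy.gDim_lt_top {k : ℕ} (h : HasReflexiveSyzygy R k M) :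
    gDim R M < ⊤ := by
  obtain ⟨P, hP⟩ := h.exists_gResolution
  refine (iInf_le _ P).trans_lt (lt_of_le_of_lt (sSup_le ?_) (ENat.natCast_lt_top k))
  rintro _ ⟨n, rfl, hn⟩
  by_contra hkn
  exact not_subsingleton_iff_nontrivial.mpr hn (hP n (by simpa using hkn))

end GResolutions

/-! ### Consequences of finite FP-injective dimension -/

section FPInjectiveDim

variable {R : Type u} [CommRing R]

theorem fpInjectiveDim_le {M : Type u} [AddCommGroup M] [Module R M] {n : ℕ}
    (h : ∀ (N : Type u) [AddCommGroup N] [Module R N], Module.FinitePresentation R N →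
      ExtVanishes R N M (n + 1)) : fpInjectiveDim R M ≤ n :=
  sInf_le ⟨n, rfl, h⟩

variable (hR : IsCoherentRing R)
include hR

theorem IsCoherentRing.extVanishes_of_fpInjectiveDim_le {M : Type u} [AddCommGroup M] [Module R M]
    {n : ℕ} (h : fpInjectiveDim R M ≤ n) (N : Type u) [AddCommGroup N] [Module R N]
    [Module.FinitePresentation R N] {i : ℕ} (hi : n < i) : ExtVanishes R N M i := by
  -- The infimum of the empty set is `⊤`, so a finite bound makes the set nonempty and the infimum
  -- is attained. Higher degrees follow by dimension shifting.
  have hne : {k : ℕ∞ | ∃ n : ℕ, k = n ∧ ∀ (N : Type u) [AddCommGroup N] [Module R N],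
      Module.FinitePresentation R N → ExtVanishes R N M (n + 1)}.Nonempty := by
    by_contra h0
    rw [Set.not_nonempty_iff_eq_empty] at h0
    rw [fpInjectiveDim, h0, sInf_empty] at h
    exact absurd h (not_le.mpr (ENat.natCast_lt_top n))
  obtain ⟨m, hm, hvan⟩ := csInf_mem hne
  have hmn : m ≤ n := Nat.cast_le.mp (hm.symm.le.trans h)
  obtain ⟨j, rfl⟩ := Nat.exists_eq_add_of_lt (hmn.trans_lt hi)
  clear hi
  induction j generalizing N with
  | zero => exact hvan N inferInstance
  | succ j ih =>
    obtain ⟨l, p, hp⟩ := Module.Finite.exists_fin' R N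
    have := hR.finitePresentation_ker p
    exact (extVanishes_left_iff (Submodule.subtype_injective _) (LinearMap.exact_subtype_ker_map p)
      hp (Nat.succ_pos _)).mp (ih (LinearMap.ker p))

variable {n : ℕ} (hn : fpInjectiveDim R R ≤ n)
include hn

/-- For a syzygy K of N, the exact sequence 0 → N* → F* → K* → 0 reduces Ext^i(N*, R) to
Ext^{i+1}(K*, R). K inherits the hypothesis, so k shifts reach a degree above n. -/
theorem IsCoherentRing.extVanishes_dual (k : ℕ) (N : Type u) [AddCommGroup N] [Module R N]
    [Module.FinitePresentation R N] (hN : ∀ i, 0 < i → ExtVanishes R N R i) {i : ℕ} (hi : 0 < i)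
    (hik : n < i + k) : ExtVanishes R (Module.Dual R N) R i := by
  induction k generalizing N i with
  | zero =>
    have := hR.finitePresentation_dual (M := N)
    exact hR.extVanishes_of_fpInjectiveDim_le hn _ hik
  | succ k ih =>
    obtain ⟨l, p, hp⟩ := Module.Finite.exists_fin' R N
    have := hR.finitePresentation_ker p
    have hi' := Submodule.subtype_injective (LinearMap.ker p)
    have hip := LinearMap.exact_subtype_ker_map p
    refine .left (LinearMap.dualMap_injective_of_surjective hp) (exact_dualMap hip hp)
      ((hN 1 one_pos).dualMap_surjective hi' hip hp) (.of_projective hi)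
      (ih (LinearMap.ker p) (fun j hj ↦ ?_) i.succ_pos (by omega))
    exact (extVanishes_left_iff hi' hip hp hj).mpr (hN _ j.succ_pos)

/-- Ext^1(K*, R) = 0 for the syzygy K makes F** → N** surjective, and F is reflexive. -/
theorem IsCoherentRing.surjective_eval (N : Type u) [AddCommGroup N] [Module R N]
    [Module.FinitePresentation R N] (hN : ∀ i, 0 < i → ExtVanishes R N R i) :
    Function.Surjective (Module.Dual.eval R N) := by
  obtain ⟨l, p, hp⟩ := Module.Finite.exists_fin' R N
  have := hR.finitePresentation_ker p
  have hi := Submodule.subtype_injective (LinearMap.ker p)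
  have hip := LinearMap.exact_subtype_ker_map p
  have hK (j : ℕ) (hj : 0 < j) : ExtVanishes R (LinearMap.ker p) R j :=
    (extVanishes_left_iff hi hip hp hj).mpr (hN _ j.succ_pos)
  intro φ
  obtain ⟨ψ, rfl⟩ := (hR.extVanishes_dual hn n (LinearMap.ker p) hK one_pos
    (by omega)).dualMap_surjective (LinearMap.dualMap_injective_of_surjective hp)
      (exact_dualMap hip hp) ((hN 1 one_pos).dualMap_surjective hi hip hp) φ
  obtain ⟨x, rfl⟩ := (Module.bijective_dual_eval R (Fin l → R)).surjective ψ
  exact ⟨p x, rfl⟩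

theorem IsCoherentRing.isTotallyReflexive (N : Type u) [AddCommGroup N] [Module R N]
    [Module.FinitePresentation R N] (hN : ∀ i, 0 < i → ExtVanishes R N R i) :
    IsTotallyReflexive R N := by
  refine ⟨hN, fun i hi ↦ hR.extVanishes_dual hn n N hN hi (by omega), ?_,
    hR.surjective_eval hn N hN⟩
  obtain ⟨l, p, hp⟩ := Module.Finite.exists_fin' R N
  have := hR.finitePresentation_ker p
  have hi := Submodule.subtype_injective (LinearMap.ker p)
  have hip := LinearMap.exact_subtype_ker_map p
  have hK (j : ℕ) (hj : 0 < j) : ExtVanishes R (LinearMap.ker p) R j :=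
    (extVanishes_left_iff hi hip hp hj).mpr (hN _ j.succ_pos)
  rw [injective_iff_map_eq_zero]
  intro x hx
  obtain ⟨y, rfl⟩ := hp x
  -- K** → F** → N** is exact and K → K** is surjective, so an element y of F that dies in N** comes
  -- from K.
  have hex := exact_dualMap (exact_dualMap hip hp) ((hN 1 one_pos).dualMap_surjective hi hip hp)
  obtain ⟨ψ, hψ⟩ := (hex (Module.Dual.eval R _ y)).mp hx
  obtain ⟨z, rfl⟩ := hR.surjective_eval hn (LinearMap.ker p) hK ψ
  have : (z : Fin l → R) = y := (Module.bijective_dual_eval R (Fin l → R)).injective hψ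
  rw [← this]
  exact z.2

theorem IsCoherentRing.hasReflexiveSyzygy (N : Type u) [AddCommGroup N] [Module R N]
    [Module.FinitePresentation R N] : HasReflexiveSyzygy R n N := by
  -- The number m of syzygies is freed from n, the fixed bound on FP-id: each syzygy lowers by one
  -- the degree above which Ext vanishes.
  suffices h : ∀ (m : ℕ) (N : Type u) [AddCommGroup N] [Module R N]
      [Module.FinitePresentation R N], (∀ i, m < i → ExtVanishes R N R i) →
      HasReflexiveSyzygy R m N from
    h n N fun i hi ↦ hR.extVanishes_of_fpInjectiveDim_le hn N hi
  intro m
  induction m with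
  | zero => exact fun N _ _ _ hN ↦ ⟨inferInstance, hR.isTotallyReflexive hn N hN⟩
  | succ m ih =>
    intro N _ _ _ hN
    obtain ⟨l, p, hp⟩ := Module.Finite.exists_fin' R N
    have := hR.finitePresentation_ker p
    have hi := Submodule.subtype_injective (LinearMap.ker p)
    have hip := LinearMap.exact_subtype_ker_map p
    refine ⟨LinearMap.ker p, Fin l → R, _, _, _, _, _, p, hi, hip, hp,
      ⟨inferInstance, inferInstance⟩, ih _ fun i hmi ↦ ?_⟩
    exact (extVanishes_left_iff hi hip hp (by omega)).mpr (hN _ (by omega))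

end FPInjectiveDim

/-! ### Faithfully flat descent and the upper bound for depth -/

section Descent

variable {R : Type u} [CommRing R] {S : Type u} [CommRing S] [Algebra R S]

/-- Linear maps to `R` extend along `i` if linear maps to `S ⊗ R` do, for `S` faithfully flat. -/
theorem dualMap_surjective_of_faithfullyFlat [Module.FaithfullyFlat R S] {K F : Type u}
    [AddCommGroup K] [Module R K] [AddCommGroup F] [Module R F] [Module.FinitePresentation R K]
    [Module.FinitePresentation R F] (i : K →ₗ[R] F)
    (h : ∀ f : K →ₗ[R] S ⊗[R] R, ∃ g : F →ₗ[R] S ⊗[R] R, g ∘ₗ i = f) :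
    Function.Surjective i.dualMap := by
  rw [← Module.FaithfullyFlat.lTensor_surjective_iff_surjective R S]
  have hF := Module.FinitePresentation.isBaseChange_map R F R S
  have hK := Module.FinitePresentation.isBaseChange_map R K R S
  -- For finitely presented modules Hom commutes with flat base change, naturally in i.
  have hcomm (u : S ⊗[R] Module.Dual R F) :
      hK.equiv (i.dualMap.lTensor S u) = hF.equiv u ∘ₗ i.baseChange S := by
    induction u with
    | zero => simp
    | add u v hu hv => rw [map_add, map_add, hu, hv, map_add, LinearMap.add_comp]
    | tmul s f =>
      rw [LinearMap.lTensor_tmul, IsBaseChange.equiv_tmul, IsBaseChange.equiv_tmul]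
      ext x
      simp [LinearMap.dualMap_apply]
  intro t
  obtain ⟨g, hg⟩ := h ((hK.equiv t).restrictScalars R ∘ₗ TensorProduct.mk R S K 1)
  refine ⟨hF.equiv.symm (g.liftBaseChange S), hK.equiv.injective ?_⟩
  rw [hcomm, LinearEquiv.apply_symm_apply]
  ext x
  simpa using LinearMap.congr_fun hg x

theorem IsCoherentRing.extVanishes_of_faithfullyFlat (hR : IsCoherentRing R)
    [Module.FaithfullyFlat R S] (N : Type u) [AddCommGroup N] [Module R N]
    [Module.FinitePresentation R N] {i : ℕ} (h : ExtVanishes R N (S ⊗[R] R) i) :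
    ExtVanishes R N R i := by
  rcases Nat.eq_zero_or_pos i with rfl | hi
  · rw [extVanishes_zero_iff] at h ⊢
    intro f
    ext x
    have := LinearMap.congr_fun (h (TensorProduct.mk R S R 1 ∘ₗ f)) x
    simpa [Module.FaithfullyFlat.one_tmul_eq_zero_iff] using this
  obtain ⟨i, rfl⟩ := Nat.exists_eq_add_of_lt hi
  rw [zero_add] at h ⊢
  clear hi
  induction i generalizing N with
  | zero =>
    obtain ⟨l, p, hp⟩ := Module.Finite.exists_fin' R N
    have := hR.finitePresentation_ker p
    have hi := Submodule.subtype_injective (LinearMap.ker p)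
    have hip := LinearMap.exact_subtype_ker_map p
    exact .one_of_exists_extension hi hip hp (.of_projective one_pos)
      (dualMap_surjective_of_faithfullyFlat _ (h.exists_extension hi hip hp))
  | succ i ih =>
    obtain ⟨l, p, hp⟩ := Module.Finite.exists_fin' R N
    have := hR.finitePresentation_ker p
    have hi := Submodule.subtype_injective (LinearMap.ker p)
    have hip := LinearMap.exact_subtype_ker_map p
    rw [← extVanishes_left_iff hi hip hp i.succ_pos] at h ⊢
    exact ih _ h

theorem exists_fg_le_of_mem_map {I : Ideal R} {r : S} (hr : r ∈ I.map (algebraMap R S)) :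
    ∃ J ≤ I, J.FG ∧ r ∈ J.map (algebraMap R S) := by
  induction hr using Submodule.span_induction with
  | mem r hr =>
    obtain ⟨x, hx, rfl⟩ := hr
    exact ⟨Ideal.span {x}, by simpa [Ideal.span_le] using hx, ⟨{x}, by simp⟩,
      Ideal.mem_map_of_mem _ (Ideal.subset_span rfl)⟩
  | zero => exact ⟨⊥, bot_le, Submodule.fg_bot, zero_mem _⟩
  | add r s _ _ h1 h2 =>
    obtain ⟨J, hJ, hJ', hr⟩ := h1
    obtain ⟨L, hL, hL', hs⟩ := h2
    exact ⟨J ⊔ L, sup_le hJ hL, Submodule.FG.sup hJ' hL', add_mem (Ideal.map_mono le_sup_left hr)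
      (Ideal.map_mono le_sup_right hs)⟩
  | smul s r _ h =>
    obtain ⟨J, hJ, hJ', hr⟩ := h
    exact ⟨J, hJ, hJ', Ideal.mul_mem_left _ s hr⟩

/-- The maximal ideal need not be finitely generated; replacing it by J makes R/J finitely
presented. -/
theorem exists_fg_le_of_forall_mem_map {I : Ideal R} (rs : List S)
    (hrs : ∀ r ∈ rs, r ∈ I.map (algebraMap R S)) :
    ∃ J ≤ I, J.FG ∧ ∀ r ∈ rs, r ∈ J.map (algebraMap R S) := by
  induction rs with
  | nil => exact ⟨⊥, bot_le, Submodule.fg_bot, by simp⟩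
  | cons r rs ih =>
    obtain ⟨J, hJ, hJ', hr⟩ := exists_fg_le_of_mem_map (hrs r (by simp))
    obtain ⟨L, hL, hL', hs⟩ := ih fun s hs ↦ hrs s (by simp [hs])
    refine ⟨J ⊔ L, sup_le hJ hL, Submodule.FG.sup hJ' hL', fun s hs' ↦ ?_⟩
    rcases List.mem_cons.mp hs' with rfl | hs'
    · exact Ideal.map_mono le_sup_left hr
    · exact Ideal.map_mono le_sup_right (hs s hs')

/-- The depth of a coherent local ring is at most its FP-injective dimension. -/
theorem IsCoherentRing.ringDepth_le [IsLocalRing R] (hR : IsCoherentRing R) {n : ℕ}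
    (hn : fpInjectiveDim R R ≤ n) : ringDepth R ≤ n := by
  refine iSup_le fun S ↦ iSup_le fun _ ↦ iSup_le fun _ ↦ iSup_le fun _ ↦ sSup_le ?_
  rintro _ ⟨rs, hrs, hreg, rfl⟩
  by_contra hlt
  rw [Nat.cast_le, not_le] at hlt
  obtain ⟨J, hJm, hJ, hrsJ⟩ := exists_fg_le_of_forall_mem_map rs hrs
  have : Module.FinitePresentation R (R ⧸ J) :=
    Module.finitePresentation_of_surjective J.mkQ J.mkQ_surjective (by rwa [J.ker_mkQ])
  have hann : ∀ j ∈ J, ∀ x : R ⧸ J, j • x = 0 := by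
    intro j hj x
    obtain ⟨x, rfl⟩ := J.mkQ_surjective x
    rw [← map_smul]
    exact (Submodule.Quotient.mk_eq_zero J).mpr (J.mul_mem_right x hj)
  -- The regular sequence covers degrees up to n, FP-id those above. Degree 0 makes the dual of R/J
  -- zero, while total reflexivity embeds R/J in its bidual.
  have hext (i : ℕ) : ExtVanishes R (R ⧸ J) R i := by
    rcases le_or_gt i n with hi | hi
    · exact hR.extVanishes_of_faithfullyFlat (S := S) _
        (.of_isWeaklyRegular hann S rs hrsJ _ hreg.toIsWeaklyRegular (hi.trans_lt hlt))
    · exact hR.extVanishes_of_fpInjectiveDim_le hn _ hi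
  have hinj := (hR.isTotallyReflexive hn _ fun i _ ↦ hext i).bijective_eval.injective
  have hzero := extVanishes_zero_iff.mp (hext 0)
  have h1 : J.mkQ 1 = 0 := hinj (LinearMap.ext fun f ↦ by rw [hzero f]; rfl)
  have : (1 : R) ∈ J := (Submodule.Quotient.mk_eq_zero J).mp h1
  exact (Ideal.ne_top_iff_one _).mp (IsLocalRing.maximalIdeal.isMaximal R).ne_top (hJm this)

end Descent

/-! ### McCoy's theorem for modules -/

section McCoy

open Polynomial

variable {B : Type u} [CommRing B] {N : Type u} [AddCommGroup N] [Module B N]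

/-- McCoy's theorem for modules: a polynomial is regular on the polynomial module if no nonzero
element of the module is killed by all its coefficients. -/
theorem isSMulRegular_polynomialModule (f : B[X])
    (hf : ∀ x : N, (∀ j, f.coeff j • x = 0) → x = 0) :
    IsSMulRegular (PolynomialModule B N) f := by
  -- Induction on a strict bound d for the degree of g.
  suffices h : ∀ (d : ℕ) (g : PolynomialModule B N), (∀ k, d ≤ k → g.coeff k = 0) →
      f • g = 0 → g = 0 by
    rw [isSMulRegular_iff_right_eq_zero_of_smul]
    intro g hg
    refine h (g.coeff.support.sup id + 1) g (fun k hk ↦ ?_) hg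
    by_contra hne
    have := Finset.le_sup (f := id) (Finsupp.mem_support_iff.mpr hne)
    simp only [id] at this
    omega
  have hsmul (c : B) (q : PolynomialModule B N) (k : ℕ) : (c • q).coeff k = c • q.coeff k := rfl
  intro d
  induction d with
  | zero =>
    intro g hg _
    ext k
    simpa using hg k (Nat.zero_le k)
  | succ d ih =>
    intro g hg hfg
    -- The coefficients of f kill g one after another, from the top. Once those above j do, the
    -- coefficient of fg in degree j + d is f_j g_d, so f_j g has smaller degree; it is killed by f
    -- and vanishes by induction.
    have key (m : ℕ) : ∀ j, f.natDegree < j + m → f.coeff j • g = 0 := by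
      induction m with
      | zero =>
        intro j hj
        rw [coeff_eq_zero_of_natDegree_lt (by simpa using hj), zero_smul]
      | succ m ihm =>
        intro j hj
        have hlarge (j' : ℕ) (hj' : j < j') : f.coeff j' • g = 0 := ihm j' (by omega)
        have htop : f.coeff j • g.coeff d = 0 := by
          have h0 : (f • g).coeff (j + d) = 0 := by rw [hfg]; rfl
          rw [PolynomialModule.smul_apply, Finset.sum_eq_single (j, d)] at h0
          · exact h0
          · rintro ⟨a, b⟩ hab hne
            rw [Finset.HasAntidiagonal.mem_antidiagonal] at hab
            simp only at hab ⊢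
            rcases lt_or_ge d b with hb | hb
            · rw [hg b hb, smul_zero]
            · have ha : j < a := by
                rcases eq_or_ne b d with rfl | hbd
                · exact absurd (by rw [Nat.add_right_cancel hab]) hne
                · omega
              have := congrArg (fun q ↦ PolynomialModule.coeff q b) (hlarge a ha)
              simpa [hsmul] using this
          · intro h
            simp at h
        refine ih _ (fun k hk ↦ ?_) ?_
        · rw [hsmul]
          rcases eq_or_lt_of_le hk with rfl | hk
          · exact htop
          · rw [hg k hk, smul_zero]
        · rw [smul_comm, hfg, smul_zero]
    ext k
    refine hf _ fun j ↦ ?_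
    have := congrArg (fun q ↦ PolynomialModule.coeff q k) (key (f.natDegree + 1) j (by omega))
    simpa [hsmul] using this

theorem isSMulRegular_polynomial_tensorProduct (f : B[X])
    (hf : ∀ x : N, (∀ j, f.coeff j • x = 0) → x = 0) :
    IsSMulRegular (B[X] ⊗[B] N) f :=
  (LinearEquiv.isSMulRegular_congr
    (PolynomialModule.polynomialTensorProductLEquivPolynomialModule B N) f).mpr
    (isSMulRegular_polynomialModule f hf)

end McCoy

/-! ### Direct summands of finite powers -/

section Retract

variable {B : Type u} [CommRing B]

/-- `T` is a direct summand of a finite power of `M`. -/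
def IsRetractOfPower (B : Type u) [CommRing B] (M T : Type u) [AddCommGroup M] [Module B M]
    [AddCommGroup T] [Module B T] : Prop :=
  ∃ (b : ℕ) (α : Fin b → (T →ₗ[B] M)) (β : Fin b → (M →ₗ[B] T)),
    ∑ k, β k ∘ₗ α k = LinearMap.id

variable {M T : Type u} [AddCommGroup M] [Module B M] [AddCommGroup T] [Module B T]

theorem IsRetractOfPower.eq_zero_of_forall_smul {ι : Type*} {a : ι → B}
    (h : IsRetractOfPower B M T) (hM : ∀ x : M, (∀ j, a j • x = 0) → x = 0) (t : T)
    (ht : ∀ j, a j • t = 0) : t = 0 := by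
  obtain ⟨b, α, β, hαβ⟩ := h
  have : (∑ k, β k ∘ₗ α k) t = t := by rw [hαβ]; rfl
  rw [← this, LinearMap.sum_apply]
  refine Finset.sum_eq_zero fun k _ ↦ ?_
  rw [LinearMap.comp_apply, hM (α k t) fun j ↦ by rw [← map_smul, ht, map_zero], map_zero]

theorem isRetractOfPower_of_free [Module.Free B T] [Module.Finite B T] :
    IsRetractOfPower B B T := by
  cases subsingleton_or_nontrivial B
  · have := Module.subsingleton B T
    exact ⟨0, Fin.elim0, Fin.elim0, LinearMap.ext fun _ ↦ Subsingleton.elim _ _⟩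
  let e := Module.finBasis B T
  refine ⟨_, fun k ↦ e.coord k, fun k ↦ LinearMap.toSpanSingleton B T (e k), ?_⟩
  ext t
  simp [e.sum_repr]

end Retract

/-! ### Reduction modulo a generic polynomial -/

section GenericQuotient

open Polynomial

variable {B : Type u} [CommRing B] (f : B[X])

/-- The reduction modulo `f` of the base change of a module to the polynomial ring. -/
abbrev GenericQuotient (N : Type u) [AddCommGroup N] [Module B N] : Type u :=
  QuotSMulTop f (B[X] ⊗[B] N)

variable {N N' N'' N''' : Type u} [AddCommGroup N] [Module B N] [AddCommGroup N'] [Module B N']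
  [AddCommGroup N''] [Module B N''] [AddCommGroup N'''] [Module B N''']

/-- The action of `GenericQuotient f` on linear maps. -/
noncomputable def genericQuotientMap (g : N →ₗ[B] N') :
    GenericQuotient f N →ₗ[B[X]] GenericQuotient f N' :=
  QuotSMulTop.map f (g.baseChange B[X])

theorem genericQuotientMap_id :
    genericQuotientMap f (LinearMap.id : N →ₗ[B] N) = LinearMap.id := by
  rw [genericQuotientMap, LinearMap.baseChange_id, QuotSMulTop.map_id]

theorem genericQuotientMap_comp (g : N' →ₗ[B] N'') (h : N →ₗ[B] N') :
    genericQuotientMap f (g ∘ₗ h) = genericQuotientMap f g ∘ₗ genericQuotientMap f h := by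
  rw [genericQuotientMap, LinearMap.baseChange_comp, QuotSMulTop.map_comp]
  rfl

theorem genericQuotientMap_sum {ι : Type*} (s : Finset ι) (g : ι → (N →ₗ[B] N')) :
    genericQuotientMap f (∑ k ∈ s, g k) = ∑ k ∈ s, genericQuotientMap f (g k) := by
  have h := map_sum (LinearMap.baseChangeHom B B[X] N N') g s
  simp only [genericQuotientMap]
  exact (congrArg _ h).trans (map_sum _ _ _)

theorem genericQuotientMap_smul (b : B) (g : N →ₗ[B] N') :
    genericQuotientMap f (b • g) = (C b : B[X]) • genericQuotientMap f g := by
  rw [genericQuotientMap, LinearMap.baseChange_smul, genericQuotientMap, ← map_smul]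
  congr 1
  ext x
  simp [smul_tmul', ← Polynomial.algebraMap_eq, Algebra.algebraMap_eq_smul_one]

/-- The terms of the complex do not stay free over B[X] after division by f. Being a summand of a
power of M does survive, and suffices to transfer regularity from M to all terms. -/
theorem IsRetractOfPower.genericQuotient (h : IsRetractOfPower B N N') :
    IsRetractOfPower B[X] (GenericQuotient f N) (GenericQuotient f N') := by
  obtain ⟨b, α, β, hαβ⟩ := h
  refine ⟨b, fun k ↦ genericQuotientMap f (α k), fun k ↦ genericQuotientMap f (β k), ?_⟩
  rw [← genericQuotientMap_id, ← hαβ, genericQuotientMap_sum]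
  simp only [genericQuotientMap_comp]

/-- f is regular on the image of d₃, so im d₂ stays embedded in the third term modulo f; right
exactness does the rest. -/
theorem genericQuotientMap_exact {d₁ : N →ₗ[B] N'} {d₂ : N' →ₗ[B] N''} {d₃ : N'' →ₗ[B] N'''}
    (h₁ : Function.Exact d₁ d₂) (h₂ : Function.Exact d₂ d₃)
    (h : IsSMulRegular (B[X] ⊗[B] N''') f) :
    Function.Exact (genericQuotientMap f d₁) (genericQuotientMap f d₂) := by
  have e₁ : Function.Exact (d₁.baseChange B[X]) (d₂.baseChange B[X]) :=
    Module.Flat.lTensor_exact B[X] h₁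
  have e₂ : Function.Exact (d₂.baseChange B[X]) (d₃.baseChange B[X]) :=
    Module.Flat.lTensor_exact B[X] h₂
  exact QuotSMulTop.map_first_exact_on_four_term_exact_of_isSMulRegular_last e₁ e₂ h

theorem genericQuotientMap_injective {d₂ : N' →ₗ[B] N''} {d₃ : N'' →ₗ[B] N'''}
    (h₁ : Function.Injective d₂) (h₂ : Function.Exact d₂ d₃)
    (h : IsSMulRegular (B[X] ⊗[B] N''') f) :
    Function.Injective (genericQuotientMap f d₂) := by
  have h0 : Function.Exact (0 : PUnit.{u + 1} →ₗ[B] N') d₂ := by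
    intro x
    rw [map_eq_zero_iff d₂ h₁]
    exact ⟨fun h ↦ ⟨0, h.symm⟩, fun ⟨_, h⟩ ↦ h.symm⟩
  have hex := genericQuotientMap_exact f h0 h₂ h
  rw [injective_iff_map_eq_zero]
  intro x hx
  obtain ⟨y, rfl⟩ := (hex x).mp hx
  obtain ⟨y, rfl⟩ := Submodule.Quotient.mk_surjective _ y
  simp [genericQuotientMap, LinearMap.baseChange_zero]

/-- If `f` is regular on `B[X] ⊗ N` and `rs` is weakly regular on the base change to `S` of its
quotient by `f`, then `f, rs` is weakly regular on `S ⊗ N`. -/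
theorem isWeaklyRegular_cons_of_genericQuotient (S : Type u) [CommRing S] [Algebra B[X] S]
    [Algebra B S] [IsScalarTower B B[X] S] [Module.Flat B[X] S] {rs : List S}
    (hf : IsSMulRegular (B[X] ⊗[B] N) f)
    (hrs : RingTheory.Sequence.IsWeaklyRegular (S ⊗[B[X]] GenericQuotient f N) rs) :
    RingTheory.Sequence.IsWeaklyRegular (S ⊗[B] N) (algebraMap B[X] S f :: rs) := by
  rw [← LinearEquiv.isWeaklyRegular_congr
    (TensorProduct.AlgebraTensorModule.cancelBaseChange B B[X] S S N),
    RingTheory.Sequence.isWeaklyRegular_cons_iff]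
  refine ⟨?_, (LinearEquiv.isWeaklyRegular_congr
    (QuotSMulTop.algebraMapTensorEquivTensorQuotSMulTop f (B[X] ⊗[B] N) S) rs).mpr hrs⟩
  have := IsSMulRegular.lTensor (R := B[X]) S (M' := B[X] ⊗[B] N) (r := f) hf
  intro x y hxy
  refine this ?_
  simpa only [algebraMap_smul] using hxy

end GenericQuotient

/-! ### Regular sequences from free resolutions -/

section DepthLowerBound

open Polynomial

theorem faithfullyFlat_polynomial (B : Type u) [CommRing B] : Module.FaithfullyFlat B B[X] := by
  cases subsingleton_or_nontrivial B
  · exact .of_linearEquiv _ B (LinearEquiv.ofSubsingleton B[X] B)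
  · infer_instance

/-- A finite free resolution of length `m + 1` with non-split last map produces, after a faithfully
flat extension, a weakly regular sequence of length `m + 1`. -/
theorem exists_isWeaklyRegular_of_exact (m : ℕ) (B : Type u) [CommRing B] (M : Type u)
    [AddCommGroup M] [Module B M] (T : ℕ → Type u) [∀ i, AddCommGroup (T i)] [∀ i, Module B (T i)]
    (d : ∀ i, T (i + 1) →ₗ[B] T i) {r : ℕ} (a : Fin r → B)
    (hT : ∀ i, IsRetractOfPower B M (T i)) (ι : M →ₗ[B] T (m + 1)) (π : T (m + 1) →ₗ[B] M)
    (hπ : π ∘ₗ ι = LinearMap.id) (ψ : Fin r → (M →ₗ[B] T m))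
    (hψ : d m ∘ₗ ι = ∑ j, a j • ψ j) (hinj : Function.Injective (d m))
    (hex : ∀ i < m, Function.Exact (d (i + 1)) (d i)) :
    ∃ (S : Type u) (_ : CommRing S) (_ : Algebra B S) (_ : Module.FaithfullyFlat B S)
      (rs : List S), rs.length = m + 1 ∧
      (∀ s ∈ rs, s ∈ (Ideal.span (Set.range a)).map (algebraMap B S)) ∧
      RingTheory.Sequence.IsWeaklyRegular (S ⊗[B] M) rs := by
  have := faithfullyFlat_polynomial B
  let f : B[X] := ∑ j : Fin r, monomial (j : ℕ) (a j)
  have hfa (j : Fin r) : f.coeff j = a j := by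
    simp [f, finsetSum_coeff, coeff_monomial, Fin.val_inj]
  have hfmem : f ∈ (Ideal.span (Set.range a)).map (algebraMap B B[X]) := by
    refine Ideal.sum_mem _ fun j _ ↦ ?_
    rw [← C_mul_X_pow_eq_monomial]
    exact Ideal.mul_mem_right _ _ (Ideal.mem_map_of_mem _ (Ideal.subset_span ⟨j, rfl⟩))
  -- If every a j kills x, then d m (ι x) = ∑ a j • ψ j x = 0, and both d m and ι are injective.
  -- This is the hypothesis of McCoy's theorem for f.
  have hM (x : M) (hx : ∀ j, a j • x = 0) : x = 0 := by
    have h1 : d m (ι x) = 0 := by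
      have := LinearMap.congr_fun hψ x
      rw [LinearMap.comp_apply] at this
      rw [this, LinearMap.sum_apply]
      refine Finset.sum_eq_zero fun j _ ↦ ?_
      rw [LinearMap.smul_apply, ← map_smul, hx, map_zero]
    rw [map_eq_zero_iff _ hinj] at h1
    rw [← LinearMap.id_apply (R := B) x, ← hπ, LinearMap.comp_apply, h1, map_zero]
  have hfM : IsSMulRegular (B[X] ⊗[B] M) f :=
    isSMulRegular_polynomial_tensorProduct f fun x hx ↦ hM x fun j ↦ by rw [← hfa]; exact hx j
  have hfT (i : ℕ) : IsSMulRegular (B[X] ⊗[B] T i) f :=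
    isSMulRegular_polynomial_tensorProduct f fun x hx ↦
      (hT i).eq_zero_of_forall_smul hM x fun j ↦ by rw [← hfa]; exact hx j
  suffices h : ∃ (S : Type u) (_ : CommRing S) (_ : Algebra B[X] S)
      (_ : Module.FaithfullyFlat B[X] S) (rs : List S), rs.length = m ∧
      (∀ s ∈ rs, s ∈ (Ideal.span (Set.range fun j ↦ (C (a j) : B[X]))).map (algebraMap B[X] S)) ∧
      RingTheory.Sequence.IsWeaklyRegular (S ⊗[B[X]] GenericQuotient f M) rs by
    obtain ⟨S, _, _, _, rs, hlen, hmem, hreg⟩ := h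
    let _ : Algebra B S := ((algebraMap B[X] S).comp (algebraMap B B[X])).toAlgebra
    have : IsScalarTower B B[X] S := .of_algebraMap_eq fun _ ↦ rfl
    have hmap : (Ideal.span (Set.range a)).map (algebraMap B S) =
        ((Ideal.span (Set.range a)).map (algebraMap B B[X])).map (algebraMap B[X] S) := by
      rw [Ideal.map_map]
      rfl
    have hspan : (Ideal.span (Set.range a)).map (algebraMap B B[X]) =
        Ideal.span (Set.range fun j ↦ (C (a j) : B[X])) := by
      rw [Ideal.map_span, ← Set.range_comp]
      rfl
    refine ⟨S, inferInstance, inferInstance, .trans B B[X] S, algebraMap B[X] S f :: rs,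
      by simp [hlen], fun s hs ↦ ?_, isWeaklyRegular_cons_of_genericQuotient f S hfM hreg⟩
    rw [hmap]
    rcases List.mem_cons.mp hs with rfl | hs
    · exact Ideal.mem_map_of_mem _ hfmem
    · rw [hspan]
      exact hmem s hs
  cases m with
  | zero =>
    exact ⟨B[X], inferInstance, inferInstance, inferInstance, [], rfl, by simp,
      RingTheory.Sequence.IsWeaklyRegular.nil _ _⟩
  | succ m =>
    -- Exactness modulo f at one place uses regularity of f one term further right, so the recursion
    -- drops T 0 and m decreases by one.
    refine exists_isWeaklyRegular_of_exact m B[X] (GenericQuotient f M)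
      (fun i ↦ GenericQuotient f (T (i + 1))) (fun i ↦ genericQuotientMap f (d (i + 1)))
      (fun j ↦ C (a j)) (fun i ↦ (hT (i + 1)).genericQuotient f) (genericQuotientMap f ι)
      (genericQuotientMap f π) ?_ (fun j ↦ genericQuotientMap f (ψ j)) ?_ ?_ fun i hi ↦ ?_
    · rw [← genericQuotientMap_comp, hπ, genericQuotientMap_id]
    · rw [← genericQuotientMap_comp, hψ, genericQuotientMap_sum]
      simp only [genericQuotientMap_smul]
    · exact genericQuotientMap_injective f hinj (hex m m.lt_succ_self) (hfT m)
    · exact genericQuotientMap_exact f (hex (i + 1) (Nat.succ_lt_succ hi))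
        (hex i (hi.trans m.lt_succ_self)) (hfT i)

end DepthLowerBound

/-! ### The Auslander–Bridger inequality and the equivalence -/

section LocalRing

variable {R : Type u} [CommRing R] [IsLocalRing R]

open IsLocalRing

theorem exists_dual_apply_eq_one {K : Type u} [AddCommGroup K] [Module R K] [Module.Free R K]
    [Module.Finite R K] {v : K} (hv : v ∉ maximalIdeal R • (⊤ : Submodule R K)) :
    ∃ π : K →ₗ[R] R, π v = 1 := by
  let b := Module.finBasis R K
  obtain ⟨k, hk⟩ : ∃ k, b.repr v k ∉ maximalIdeal R := by
    by_contra! h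
    refine hv ?_
    rw [← b.sum_repr v]
    exact Submodule.sum_mem _ fun k _ ↦ Submodule.smul_mem_smul (h k) trivial
  rw [mem_maximalIdeal, mem_nonunits_iff, not_not] at hk
  obtain ⟨c, hc⟩ := hk
  refine ⟨(↑c⁻¹ : R) • b.coord k, ?_⟩
  rw [LinearMap.smul_apply, Module.Basis.coord_apply, ← hc, smul_eq_mul, Units.inv_mul]

omit [IsLocalRing R] in
theorem apply_mem_of_mem_smul_top {K : Type u} [AddCommGroup K] [Module R K] {I : Ideal R} {v : K}
    (hv : v ∈ I • (⊤ : Submodule R K)) (φ : K →ₗ[R] R) : φ v ∈ I := by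
  induction hv using Submodule.smul_induction_on' with
  | smul r hr x _ =>
    rw [map_smul, smul_eq_mul]
    exact I.mul_mem_right _ hr
  | add x _ y _ hx hy =>
    rw [map_add]
    exact I.add_mem hx hy

/-- A map of finite free modules over a local ring is split injective unless it maps some
unimodular vector into the maximal ideal times the target. -/
theorem exists_retraction_or_exists_mem_smul {K F : Type u} [AddCommGroup K] [Module R K]
    [AddCommGroup F] [Module R F] [Module.Free R K] [Module.Finite R K] [Module.Free R F]
    [Module.Finite R F] (i : K →ₗ[R] F) :
    (∃ s : F →ₗ[R] K, s ∘ₗ i = LinearMap.id) ∨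
      ∃ (v : K) (π : K →ₗ[R] R), π v = 1 ∧ i v ∈ maximalIdeal R • (⊤ : Submodule R F) := by
  -- Over a local ring, i splits if and only if it is injective modulo m. A nonzero kernel vector
  -- there lifts to v outside mK, and such a v has a unit coordinate.
  rw [or_iff_not_imp_left, split_injective_iff_lTensor_residueField_injective,
    injective_iff_map_eq_zero]
  intro h
  push Not at h
  obtain ⟨z, hz, hz0⟩ := h
  obtain ⟨v, rfl⟩ := TensorProduct.mk_surjective R K (ResidueField R) residue_surjective z
  have hker (P : Type u) [AddCommGroup P] [Module R P] (x : P) :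
      x ∈ maximalIdeal R • (⊤ : Submodule R P) ↔ (1 : ResidueField R) ⊗ₜ[R] x = 0 := by
    have := LinearMap.ker_tensorProductMk (Q := P) (I := maximalIdeal R)
    rw [← this]
    rfl
  obtain ⟨π, hπ⟩ := exists_dual_apply_eq_one (v := v) (by rwa [hker])
  exact ⟨v, π, hπ, (hker F _).mpr hz⟩

/-- `W` has a resolution of length `m + 1` by finite free modules, with non-split last map. -/
def HasNonsplitResolution (m : ℕ) (W : Type u) [AddCommGroup W] [Module R W] : Prop :=
  ∃ (T : ℕ → ModuleCat.{u} R) (d : ∀ i, T (i + 1) →ₗ[R] T i) (ε : T 0 →ₗ[R] W),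
    (∀ i, IsFiniteFree R (T i)) ∧ Function.Surjective ε ∧ Function.Exact (d 0) ε ∧
    Function.Injective (d m) ∧ (∀ i < m, Function.Exact (d (i + 1)) (d i)) ∧
    ∃ (v : T (m + 1)) (π : T (m + 1) →ₗ[R] R), π v = 1 ∧
      d m v ∈ maximalIdeal R • (⊤ : Submodule R (T m))

theorem HasFreeResolution.succ_cases {m : ℕ} {W : Type u} [AddCommGroup W] [Module R W]
    (h : HasFreeResolution R (m + 1) W) :
    HasFreeResolution R m W ∨ HasNonsplitResolution (R := R) m W := by
  induction m generalizing W with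
  | zero =>
    obtain ⟨K, F, _, _, _, _, i, p, hi, hip, hp, hF, hK⟩ := h
    have ⟨_, _⟩ := hF
    have ⟨_, _⟩ := hK
    -- If the last map splits, W is a summand of F, hence projective, hence free because R is local.
    rcases exists_retraction_or_exists_mem_smul i with ⟨s, hs⟩ | hv
    · left
      have hsplit := hip.split_tfae'.out 1 0
      obtain ⟨_, t, ht⟩ := hsplit.mp ⟨hp, s, hs⟩
      have : Module.Projective R W := .of_split t p ht
      have : Module.Finite R W := .of_surjective p hp
      exact ⟨Module.free_of_flat_of_isLocalRing, inferInstance⟩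
    · right
      refine ⟨fun n ↦ match n with
        | 0 => ModuleCat.of R F
        | 1 => ModuleCat.of R K
        | _ + 2 => ModuleCat.of R PUnit, fun n ↦ match n with
        | 0 => i
        | _ + 1 => 0, p, fun n ↦ match n with
        | 0 => hF
        | 1 => hK
        | _ + 2 => ?_, hp, hip, hi, fun n hn ↦ absurd hn n.not_lt_zero, hv⟩
      exact ⟨inferInstanceAs (Module.Free R PUnit.{u + 1}),
        inferInstanceAs (Module.Finite R PUnit.{u + 1})⟩
  | succ m ih =>
    obtain ⟨K, F, _, _, _, _, i, p, hi, hip, hp, hF, hK⟩ := h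
    rcases ih hK with hK | ⟨T, d, ε, hT, hε, hdε, hinj, hex, hv⟩
    · exact .inl ⟨K, F, _, _, _, _, i, p, hi, hip, hp, hF, hK⟩
    · right
      refine ⟨fun n ↦ match n with
        | 0 => ModuleCat.of R F
        | n + 1 => T n, fun n ↦ match n with
        | 0 => i ∘ₗ ε
        | n + 1 => d n, p, fun n ↦ match n with
        | 0 => hF
        | n + 1 => hT n, hp, ?_, hinj, fun n hn ↦ match n with
        | 0 => ?_
        | n + 1 => hex n (Nat.lt_of_succ_lt_succ hn), hv⟩
      · intro x
        rw [hip x]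
        exact Set.ext_iff.mp (hε.range_comp i).symm x
      · intro x
        rw [← hdε x]
        exact map_eq_zero_iff i hi

theorem HasNonsplitResolution.succ_le_ringDepth {m : ℕ} {W : Type u} [AddCommGroup W] [Module R W]
    (h : HasNonsplitResolution (R := R) m W) : ((m + 1 : ℕ) : ℕ∞) ≤ ringDepth R := by
  obtain ⟨T, d, ε, hT, -, -, hinj, hex, v, π, hπ, hv⟩ := h
  have (i : ℕ) : Module.Free R (T i) := (hT i).1
  have (i : ℕ) : Module.Finite R (T i) := (hT i).2
  let b := Module.finBasis R (T m)
  let a (j) : R := b.repr (d m v) j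
  have ha : Ideal.span (Set.range a) ≤ maximalIdeal R := by
    rw [Ideal.span_le]
    rintro _ ⟨j, rfl⟩
    exact apply_mem_of_mem_smul_top hv (b.coord j)
  obtain ⟨S, _, _, _, rs, hlen, hmem, hreg⟩ := exists_isWeaklyRegular_of_exact m R R
    (fun i ↦ T i) d a (fun i ↦ isRetractOfPower_of_free)
    (LinearMap.toSpanSingleton R _ v) π (LinearMap.ext_ring (by simp [hπ]))
    (fun j ↦ LinearMap.toSpanSingleton R _ (b j))
    (LinearMap.ext_ring (by simp [a, b.sum_repr])) hinj hex
  have hmem' (s : S) (hs : s ∈ rs) : s ∈ (maximalIdeal R).map (algebraMap R S) :=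
    Ideal.map_mono ha (hmem s hs)
  -- By faithful flatness mS is proper; this upgrades weakly regular to regular.
  have hne : (maximalIdeal R).map (algebraMap R S) • (⊤ : Submodule S (S ⊗[R] R)) ≠ ⊤ := by
    rw [(TensorProduct.isBaseChange R R S).map_smul_top_ne_top_iff_of_faithfullyFlat]
    simpa using (maximalIdeal.isMaximal R).ne_top
  have hreg' : RingTheory.Sequence.IsRegular (S ⊗[R] R) rs := by
    refine ⟨hreg, fun htop ↦ hne (eq_top_iff.mpr ?_)⟩
    refine htop.le.trans (Submodule.smul_mono_left ?_)
    exact Ideal.span_le.mpr fun s hs ↦ hmem' s hs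
  calc ((m + 1 : ℕ) : ℕ∞) = rs.length := by rw [hlen]
    _ ≤ classicalDepth ((maximalIdeal R).map (algebraMap R S)) (S ⊗[R] R) :=
      le_sSup ⟨rs, hmem', hreg', rfl⟩
    _ ≤ ringDepth R :=
      le_iSup_of_le S (le_iSup_of_le _ (le_iSup_of_le _ (le_iSup_of_le ‹_› le_rfl)))

theorem HasFreeResolution.exists_le_ringDepth {k : ℕ} {W : Type u} [AddCommGroup W] [Module R W]
    (h : HasFreeResolution R k W) {n : ℕ} (hn : ringDepth R ≤ n) :
    ∃ l ≤ n, HasFreeResolution R l W := by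
  induction k with
  | zero => exact ⟨0, Nat.zero_le n, h⟩
  | succ k ih =>
    rcases h.succ_cases with h | h
    · exact ih h
    · exact ⟨k + 1, Nat.cast_le.mp (h.succ_le_ringDepth.trans hn), ‹_›⟩

/-- The inequality of the Auslander–Bridger formula: a finitely presented module of finite
G-dimension has G-dimension at most the depth of the ring. -/
theorem IsCoherentRing.extVanishes_of_ringDepth_lt (hR : IsCoherentRing R) {N : Type u}
    [AddCommGroup N] [Module R N] {k : ℕ} (h : HasReflexiveSyzygy R k N) {n : ℕ}
    (hn : ringDepth R ≤ n) {i : ℕ} (hi : n < i) : ExtVanishes R N R i := by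
  -- Ext^i(N, R) lies between Ext^i(W, R) and Ext^{i+1}(C, R). The latter vanishes, and W has a free
  -- resolution of length at most n.
  obtain ⟨W, C, _, _, _, _, j, p, hj, hjp, hp, hW, hC⟩ := h.exists_approximation hR
  obtain ⟨l, hl, hW⟩ := hW.exists_le_ringDepth hn
  exact .left hj hjp hp (hW.extVanishes (hl.trans_lt hi)) (hC.2.ext_vanishes _ i.succ_pos)

theorem IsCoherentRing.isGorenstein_of_fpInjectiveDim_eq (hR : IsCoherentRing R) {n : ℕ}
    (hn : fpInjectiveDim R R = n) : IsGorenstein R := by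
  intro I hI
  have := hR I hI
  exact (hR.hasReflexiveSyzygy hn.le I).gDim_lt_top

theorem IsCoherentRing.ringDepth_eq_of_fpInjectiveDim_eq (hR : IsCoherentRing R) {n : ℕ}
    (hn : fpInjectiveDim R R = n) : ringDepth R = n := by
  refine le_antisymm (hR.ringDepth_le hn.le) ?_
  by_contra hlt
  rw [not_le] at hlt
  obtain ⟨k, hk⟩ := ENat.ne_top_iff_exists.mp (hlt.trans_le le_top).ne
  -- If the depth were k < n, the Auslander–Bridger inequality would bound FP-id by k.
  have : fpInjectiveDim R R ≤ k := fpInjectiveDim_le fun N _ _ _ ↦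
    hR.extVanishes_of_ringDepth_lt (hR.hasReflexiveSyzygy hn.le N) hk.ge k.lt_succ_self
  rw [hn, hk] at this
  exact absurd hlt (not_lt.mpr this)

theorem IsCoherentRing.fpInjectiveDim_eq_of_isGorenstein (hR : IsCoherentRing R)
    (hG : IsGorenstein R) {n : ℕ} (hn : ringDepth R = n) : fpInjectiveDim R R = n := by
  -- The Gorenstein condition concerns ideals I, and passing to R/I costs one degree. The weaker
  -- bound n + 1 does no harm, as only finiteness is used afterwards.
  have hle : fpInjectiveDim R R ≤ ((n + 1 : ℕ) : ℕ∞) := by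
    refine fpInjectiveDim_le fun N _ _ _ ↦ hR.extVanishes_of_cyclic (Nat.succ_pos _) fun I hI ↦ ?_
    have := hR I hI
    obtain ⟨k, hk⟩ := exists_gDimLE_of_gDim_lt_top (hG I hI)
    exact (extVanishes_left_iff I.subtype_injective (LinearMap.exact_subtype_mkQ I)
      I.mkQ_surjective n.succ_pos).mp
      (hR.extVanishes_of_ringDepth_lt (.of_gDimLE hR hk) hn.le n.lt_succ_self)
  obtain ⟨m, hm⟩ := ENat.ne_top_iff_exists.mp (hle.trans_lt (ENat.natCast_lt_top _)).ne
  rw [← hm, ← hn, hR.ringDepth_eq_of_fpInjectiveDim_eq hm.symm]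

end LocalRing

end CoherentGorenstein

theorem theorem5p16 {R : Type u} [CommRing R] [IsLocalRing R]
    (hR : CoherentGorenstein.IsCoherentRing R) (n : ℕ) :
    CoherentGorenstein.fpInjectiveDim R R = (n : ℕ∞) ↔
      CoherentGorenstein.IsGorenstein R ∧ CoherentGorenstein.ringDepth R = (n : ℕ∞) :=
  ⟨fun h ↦ ⟨hR.isGorenstein_of_fpInjectiveDim_eq h, hR.ringDepth_eq_of_fpInjectiveDim_eq h⟩,
    fun h ↦ hR.fpInjectiveDim_eq_of_isGorenstein h.1 h.2⟩
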